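/- Let $d,D\ge 0$ be integers and let $M\subset\mathbb R^D$ be a nonempty compact $d$-dimensional embedded submanifold without boundary of class $C^{2,1}$ (not necessarily connected), with tangent spaces $T_pM$ and normal spaces $T_p^\perp M=(T_pM)^\perp$, regarded as linear subspaces of $\mathbb R^D$. Let $\tau,R,\varepsilon>0$. Assume that: * $\mathrm{reach}(M)\ge\tau$, where $\mathrm{reach}(M)\in[0,\infty]$ is the supremum of all $r\ge 0$ such that every $x\in\mathbb R^D$ with $\mathrm{dist}(x,M)\le r$ has a unique nearest point in $M$; * $M$ is $R$-exposed: for every $p\in M$ there is a closed ball of radius $R$ which contains $M$ and has $p$ on its boundary. Let $K=\mathrm{conv}(M)$ be the convex hull of $M$. For $p\in M$ let $$N_K(p)=\{v\in\mathbb R^D:\ \langle v,x-p\rangle\le 0\ \text{ for all } x\in K\}$$ be the outward normal cone of $K$ at $p$, and let $S_K(p)=N_K(p)\cap B_1(0)$, where $B_r(0)$ is the open ball of radius $r$ centered at the origin. Let $G\subset\mathbb R^D$ be a Borel set (possibly of infinite volume) such that for every $v\in G$ there is a point $p\in M$ for which $v$ lies in the relative interior of $N_K(p)$ and $$v+\bigl(B_\varepsilon(0)\cap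 T_p^\perp M\bigr)\subseteq N_K(p).$$ Then $$\frac{\mathrm{vol}_D(G)}{\omega_D}\ \ge\ \Bigl(\frac{\varepsilon\tau}{R}\Bigr)^{d}\ \inf_{p\in M}\frac{\mathrm{vol}_{D-d}(S_K(p)\cap G)}{\mathrm{vol}_{D-d}(S_K(p))},$$ where $\omega_D$ is the volume of the unit ball in $\mathbb R^D$, $\mathrm{vol}_D$ is Lebesgue measure, and $\mathrm{vol}_{D-d}$ is the $(D-d)$-dimensional Euclidean volume (normalized Hausdorff measure). -/

import Mathlib

open MeasureTheory

namespace NormalCones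

variable {D : ℕ}

/-- `M ⊆ ℝ^D` is an embedded `d`-dimensional submanifold (without boundary) of class `C^{2,1}`:
near each of its points it is the homeomorphic image of an open subset of `ℝ^d` under an immersion
of class `C^2` whose second derivative is locally Lipschitz. -/
def IsC21Submanifold (d : ℕ) (M : Set (EuclideanSpace ℝ (Fin D))) : Prop :=
  ∀ p ∈ M, ∃ (U : Set (EuclideanSpace ℝ (Fin D))) (V : Set (EuclideanSpace ℝ (Fin d)))
    (φ : EuclideanSpace ℝ (Fin d) → EuclideanSpace ℝ (Fin D)),
    IsOpen U ∧ p ∈ U ∧ IsOpen V ∧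
    ContDiffOn ℝ 2 φ V ∧ LocallyLipschitzOn V (iteratedFDeriv ℝ 2 φ) ∧
    (∀ x ∈ V, Function.Injective (fderiv ℝ φ x)) ∧
    Topology.IsEmbedding (V.domRestrict φ) ∧ φ '' V = M ∩ U

/-- The reach of `A`: the supremum of all `r ≥ 0` such that every point at distance at most `r`
from `A` has a unique nearest point in `A`. -/
noncomputable def reach (A : Set (EuclideanSpace ℝ (Fin D))) : ENNReal :=
  sSup ((fun r : NNReal => (r : ENNReal)) '' {r : NNReal |
    ∀ x : EuclideanSpace ℝ (Fin D), Metric.infDist x A ≤ r →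
      ∃! a : EuclideanSpace ℝ (Fin D), a ∈ A ∧ dist x a = Metric.infDist x A})

/-- `M` is `R`-exposed: for every `p ∈ M` some closed ball of radius `R` contains `M` and
has `p` on its boundary sphere. -/
def IsExposed (R : ℝ) (M : Set (EuclideanSpace ℝ (Fin D))) : Prop :=
  ∀ p ∈ M, ∃ z : EuclideanSpace ℝ (Fin D), M ⊆ Metric.closedBall z R ∧ p ∈ Metric.sphere z R

/-- The tangent space `T_p M`, a linear subspace of `ℝ^D`. (For a submanifold, the tangent cone
at `p` is already a linear subspace.) -/
noncomputable def tangentSpace (M : Set (EuclideanSpace ℝ (Fin D)))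
    (p : EuclideanSpace ℝ (Fin D)) : Submodule ℝ (EuclideanSpace ℝ (Fin D)) :=
  Submodule.span ℝ (tangentConeAt ℝ M p)

/-- The normal space `T_p^⊥ M`. -/
noncomputable def normalSpace (M : Set (EuclideanSpace ℝ (Fin D)))
    (p : EuclideanSpace ℝ (Fin D)) : Submodule ℝ (EuclideanSpace ℝ (Fin D)) :=
  (tangentSpace M p)ᗮ

/-- The outward normal cone `N_K(p)`. -/
def normalCone (K : Set (EuclideanSpace ℝ (Fin D))) (p : EuclideanSpace ℝ (Fin D)) :
    Set (EuclideanSpace ℝ (Fin D)) :=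
  {v | ∀ x ∈ K, inner ℝ v (x - p) ≤ 0}

/-- `S_K(p)`, the intersection of `N_K(p)` with the unit ball. -/
def unitNormalCone (K : Set (EuclideanSpace ℝ (Fin D))) (p : EuclideanSpace ℝ (Fin D)) :
    Set (EuclideanSpace ℝ (Fin D)) :=
  normalCone K p ∩ Metric.ball 0 1

end NormalCones

/-! A linear functional attains its maximum over the compact set `M` at some point, so the normal
cones of `K` at points of `M` cover the whole space. Both the unit ball and `G` can therefore be
measured by integrating over the normal bundle of `M`.

Over a chart `φ`, a pair `(x, y)` is sent to the vector `v` that is normal to `M` at `φ x` and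
projects to `y` in a fixed subspace `W`. The Jacobian is a factor depending on `x` only, times the
determinant of the second fundamental form `-⟪v, D²φ⟫` (`det_fderiv_bundleParam`). For `v` in a
normal cone this form is positive semidefinite.

The form is compared with the Gram form `Dφᵀ Dφ`. If `‖v‖ ≤ 1`, Federer's inequality for `-v` bounds
it above by `1/τ` times the Gram form (`inner_neg_le_of_mem_normalCone`). If `v ∈ G`, then `v - s u`
stays in the cone for every `s < ε`, where `u` is the outward unit normal of the exposing ball; this
bounds the form below by `ε/R` times the Gram form (`inner_le_of_ball_subset_normalCone`).

By monotonicity of the determinant, the ball has volume at most `τ⁻ᵈ ∫ vol S_K(p)`, and `G` has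
volume at least `(ε/R)ᵈ ∫ vol (N_K(p) ∩ G)`, with the same density on the base. The fibers compare
through the infimum (`measure_fiber_le`, `volume_coneUnion_le`), and countably many charts are glued
in `mul_volume_le_of_local`. -/

namespace NormalCones

variable {D : ℕ}

/-! ### Monotonicity of the determinant on positive semidefinite operators. -/

section Determinant

theorem det_le_one_of_posSemidef_one_sub {n : Type*} [Fintype n] [DecidableEq n]
    {A : Matrix n n ℝ} (hA : A.PosSemidef) (hA' : (1 - A).PosSemidef) : A.det ≤ 1 := by
  rw [hA.1.det_eq_prod_eigenvalues]
  refine Finset.prod_le_one (fun i _ => hA.eigenvalues_nonneg i) fun i _ => ?_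
  have h := hA'.dotProduct_mulVec_nonneg (hA.1.eigenvectorBasis i).ofLp
  have h1 : star (hA.1.eigenvectorBasis i).ofLp ⬝ᵥ (hA.1.eigenvectorBasis i).ofLp = (1 : ℝ) := by
    have := hA.1.eigenvectorBasis.orthonormal.1 i
    have h2 : inner ℝ (hA.1.eigenvectorBasis i) (hA.1.eigenvectorBasis i) = (1 : ℝ) := by
      rw [real_inner_self_eq_norm_sq, this]; norm_num
    rw [EuclideanSpace.inner_eq_star_dotProduct, dotProduct_comm] at h2
    exact h2
  rw [Matrix.sub_mulVec, Matrix.one_mulVec, hA.1.mulVec_eigenvectorBasis, dotProduct_sub,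
    dotProduct_smul, h1] at h
  simpa using h

open scoped MatrixOrder in
-- Conjugating by the inverse square root of `B` reduces to `B = 1`, where all eigenvalues lie in
-- `[0, 1]`.
theorem matrix_det_le_det {n : Type*} [Fintype n] [DecidableEq n]
    {A B : Matrix n n ℝ} (hA : A.PosSemidef) (hB : B.PosDef) (h : (B - A).PosSemidef) :
    A.det ≤ B.det := by
  set C := CFC.sqrt B with hC
  have hCC : C * C = B := CFC.sqrt_mul_sqrt_self B hB.posSemidef.nonneg
  have hCp : C.PosSemidef := Matrix.nonneg_iff_posSemidef.1 (CFC.sqrt_nonneg B)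
  have hdet : IsUnit C.det := by
    have := hB.det_pos
    rw [← hCC, Matrix.det_mul] at this
    exact isUnit_iff_ne_zero.2 fun h0 => by simp [h0] at this
  have hCi : (C⁻¹).conjTranspose = C⁻¹ := by
    rw [Matrix.conjTranspose_nonsing_inv, hCp.1]
  have h1 : (C⁻¹ * A * C⁻¹).PosSemidef := by
    have := hA.conjTranspose_mul_mul_same C⁻¹
    rwa [hCi] at this
  have h2 : (1 - C⁻¹ * A * C⁻¹).PosSemidef := by
    have := h.conjTranspose_mul_mul_same C⁻¹
    rw [hCi, ← hCC] at this
    convert this using 1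
    rw [mul_sub, sub_mul, ← mul_assoc, Matrix.nonsing_inv_mul _ hdet, one_mul,
      Matrix.mul_nonsing_inv _ hdet]
  have h3 := det_le_one_of_posSemidef_one_sub h1 h2
  have h4 : A = C * (C⁻¹ * A * C⁻¹) * C := by
    rw [← mul_assoc, ← mul_assoc, Matrix.mul_nonsing_inv _ hdet, one_mul, mul_assoc,
      Matrix.nonsing_inv_mul _ hdet, mul_one]
  rw [h4, ← hCC, Matrix.det_mul, Matrix.det_mul, Matrix.det_mul C C]
  nlinarith [sq_nonneg C.det]

variable {E : Type*} [NormedAddCommGroup E] [InnerProductSpace ℝ E] [FiniteDimensional ℝ E]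

theorem _root_.LinearMap.IsPositive.det_nonneg {P : E →ₗ[ℝ] E} (hP : P.IsPositive) :
    0 ≤ LinearMap.det P := by
  rw [← LinearMap.det_toMatrix (stdOrthonormalBasis ℝ E).toBasis]
  exact ((LinearMap.posSemidef_toMatrix_iff (stdOrthonormalBasis ℝ E)).2 hP).det_nonneg

theorem _root_.LinearMap.IsPositive.det_le_det {P Q : E →ₗ[ℝ] E} (hP : P.IsPositive)
    (hQ : Q.IsPositive) (hQi : Function.Injective Q) (h : (Q - P).IsPositive) :
    LinearMap.det P ≤ LinearMap.det Q := by
  set b := stdOrthonormalBasis ℝ E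
  rw [← LinearMap.det_toMatrix b.toBasis P, ← LinearMap.det_toMatrix b.toBasis Q]
  have hQ' := (LinearMap.posSemidef_toMatrix_iff b).2 hQ
  refine matrix_det_le_det ((LinearMap.posSemidef_toMatrix_iff b).2 hP)
    ((hQ'.posDef_iff_det_ne_zero).2 ?_) ?_
  · rw [LinearMap.det_toMatrix]
    exact (LinearMap.isUnit_det Q ((LinearMap.isUnit_iff_ker_eq_bot Q).2
      (LinearMap.ker_eq_bot.2 hQi))).ne_zero
  · rw [← map_sub]
    exact (LinearMap.posSemidef_toMatrix_iff b).2 h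

end Determinant

/-! ### Hausdorff measure under injective linear maps. -/

section Hausdorff

/-- An injective linear map scales the Hausdorff measure of the dimension of its source by a
positive constant. -/
theorem exists_euclideanHausdorffMeasure_image_eq {W F : Type*}
    [NormedAddCommGroup W] [InnerProductSpace ℝ W] [FiniteDimensional ℝ W] [MeasurableSpace W]
    [BorelSpace W] [NormedAddCommGroup F] [InnerProductSpace ℝ F] [FiniteDimensional ℝ F]
    [MeasurableSpace F] [BorelSpace F] (L : W →ₗ[ℝ] F) (hL : Function.Injective L) :
    ∃ c : ENNReal, c ≠ 0 ∧ c ≠ ⊤ ∧ ∀ A : Set W,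
      μHE[Module.finrank ℝ W] (L '' A) = c * μHE[Module.finrank ℝ W] A := by
  let e : W ≃ₗ[ℝ] LinearMap.range L := LinearEquiv.ofInjective L hL
  have hfr : Module.finrank ℝ W = Module.finrank ℝ (LinearMap.range L) := e.finrank_eq
  -- An isometry of `W` with the range turns `L` into an endomorphism `T` of `W`, whose determinant
  -- is the scaling factor.
  let φ : W ≃ₗᵢ[ℝ] LinearMap.range L := (stdOrthonormalBasis ℝ W).equiv
    (stdOrthonormalBasis ℝ (LinearMap.range L)) (finCongr hfr)
  let T : W →ₗ[ℝ] W := (e.trans φ.symm.toLinearEquiv : W ≃ₗ[ℝ] W)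
  have hT : LinearMap.det T ≠ 0 := (LinearEquiv.isUnit_det' (e.trans φ.symm.toLinearEquiv)).ne_zero
  refine ⟨ENNReal.ofReal |LinearMap.det T|, ?_, ENNReal.ofReal_ne_top, fun A => ?_⟩
  · simpa using hT
  · have h1 : L '' A = (fun w => ((φ w : LinearMap.range L) : F)) '' (T '' A) := by
      rw [Set.image_image]
      refine Set.image_congr fun w _ => ?_
      simp [T, e]
    have hiso : Isometry (fun w => ((φ w : LinearMap.range L) : F)) :=
      isometry_subtype_coe.comp φ.isometry
    rw [h1, hiso.euclideanHausdorffMeasure_image, Measure.addHaar_image_linearMap]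

end Hausdorff

/-! ### Unique nearest points and Federer's inequality. -/

section Reach

open Filter Topology Metric

/-- Every point at distance less than `τ` from `M` has at most one nearest point in `M`. -/
def UniqueNearest {X : Type*} [PseudoMetricSpace X] (τ : ℝ) (M : Set X) : Prop :=
  ∀ x : X, infDist x M < τ → ∀ a ∈ M, ∀ b ∈ M, dist x a = infDist x M →
    dist x b = infDist x M → a = b

theorem uniqueNearest_of_le_reach {M : Set (EuclideanSpace ℝ (Fin D))} {τ : ℝ}
    (h : ENNReal.ofReal τ ≤ reach M) : UniqueNearest τ M := by
  intro x hx a ha b hb hxa hxb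
  have h0 : 0 ≤ infDist x M := infDist_nonneg
  have h1 : ENNReal.ofReal (infDist x M) < reach M :=
    lt_of_lt_of_le ((ENNReal.ofReal_lt_ofReal_iff (h0.trans_lt hx)).2 hx) h
  obtain ⟨_, ⟨r, hr, rfl⟩, hlt⟩ := lt_sSup_iff.1 h1
  have hle : infDist x M ≤ r := by
    have := (ENNReal.ofReal_le_iff_le_toReal ENNReal.coe_ne_top).1 hlt.le
    simpa using this
  exact (hr x hle).unique ⟨ha, hxa⟩ ⟨hb, hxb⟩

/-- Continuity of the nearest-point projection: by compactness and uniqueness, the part of `M` away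
from `a` is strictly farther from `x` than `a` is, and this persists near `x`. -/
theorem eventually_nearest_mem {X : Type*} [PseudoMetricSpace X] {M : Set X} (hM : IsCompact M) {τ : ℝ} (hU : UniqueNearest τ M)
    {x a : X} (hx : infDist x M < τ) (ha : a ∈ M) (hxa : dist x a = infDist x M)
    {O : Set X} (hO : O ∈ 𝓝 a) :
    ∀ᶠ y in 𝓝 x, ∀ b ∈ M, dist y b = infDist y M → b ∈ O := by
  set N := M \ interior O with hN
  have hNc : IsCompact N := hM.diff isOpen_interior
  rcases N.eq_empty_or_nonempty with h | h
  · refine Eventually.of_forall fun y b hb _ => interior_subset ?_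
    by_contra hbO
    exact (h ▸ (⟨hb, hbO⟩ : b ∈ N) : b ∈ (∅ : Set X))
  · obtain ⟨c, hc, hxc⟩ := hNc.exists_infDist_eq_dist h x
    have hlt : infDist x M < infDist x N := by
      refine lt_of_le_of_ne (infDist_le_infDist_of_subset Set.sdiff_subset h) fun heq => ?_
      have := hU x hx a ha c hc.1 hxa (by rw [← hxc, heq])
      exact hc.2 (this ▸ mem_interior_iff_mem_nhds.2 hO)
    have hc1 : Continuous fun y => infDist y M := continuous_infDist_pt M
    have hc2 : Continuous fun y => infDist y N := continuous_infDist_pt N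
    filter_upwards [hc1.continuousAt.eventually_lt hc2.continuousAt hlt] with y hy b hb hyb
    by_contra hbO
    have hbN : b ∈ N := ⟨hb, fun h => hbO (interior_subset h)⟩
    have := infDist_le_dist_of_mem (x := y) hbN
    linarith

variable {F : Type*} [NormedAddCommGroup F] [InnerProductSpace ℝ F]

/-- The distance to `M` grows at almost unit speed along the unit vector `u` from the nearest point
`a` to `x`: the nearest points `b` of `x + h • u` stay close to `a`, so `u` is almost parallel to `x
- b`. -/
theorem exists_infDist_growth {M : Set F} (hM : IsCompact M) (hne : M.Nonempty) {τ : ℝ}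
    (hU : UniqueNearest τ M) {x : F} (hx0 : 0 < infDist x M) (hx : infDist x M < τ)
    {η : ℝ} (hη : 0 < η) {δ : ℝ} (hδ : 0 < δ) :
    ∃ y, 0 < dist y x ∧ dist y x < δ ∧ infDist x M + (1 - η) * dist y x ≤ infDist y M := by
  obtain ⟨a, ha, hxa⟩ := hM.exists_infDist_eq_dist hne x
  set r := infDist x M with hr
  have hna : ‖x - a‖ = r := by rw [← dist_eq_norm, ← hxa]
  set u : F := r⁻¹ • (x - a) with hu
  have hun : ‖u‖ = 1 := by
    rw [hu, norm_smul, hna, Real.norm_of_nonneg (inv_nonneg.2 hx0.le), inv_mul_cancel₀ hx0.ne']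
  have hcont : ContinuousAt (fun b : F => inner ℝ u (x - b) / ‖x - b‖) a := by
    refine ContinuousAt.div (by fun_prop) (by fun_prop) ?_
    rw [hna]; exact hx0.ne'
  have hval : inner ℝ u (x - a) / ‖x - a‖ = 1 := by
    rw [hu, real_inner_smul_left, real_inner_self_eq_norm_sq, hna]
    field_simp
  have hO : {b : F | 1 - η < inner ℝ u (x - b) / ‖x - b‖} ∈ 𝓝 a :=
    hcont.eventually (lt_mem_nhds (by simp only [hval]; linarith))
  have hev := eventually_nearest_mem hM hU hx ha hxa.symm hO
  have hev2 : ∀ᶠ h : ℝ in 𝓝[>] 0, ∀ b ∈ M, dist (x + h • u) b = infDist (x + h • u) M →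
      1 - η < inner ℝ u (x - b) / ‖x - b‖ := by
    have hct : Tendsto (fun h : ℝ => x + h • u) (𝓝[>] 0) (𝓝 x) := by
      have : Continuous fun h : ℝ => x + h • u := by fun_prop
      simpa using (this.tendsto 0).mono_left nhdsWithin_le_nhds
    exact hct.eventually hev
  obtain ⟨h, hh, hh0, hhδ⟩ := (hev2.and (Ioo_mem_nhdsGT hδ)).exists
  refine ⟨x + h • u, ?_⟩
  have hd : dist (x + h • u) x = h := by
    rw [dist_eq_norm, add_sub_cancel_left, norm_smul, hun, mul_one, Real.norm_of_nonneg hh0.le]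
  obtain ⟨b, hb, hyb⟩ := hM.exists_infDist_eq_dist hne (x + h • u)
  have h1 := hh b hb hyb.symm
  have hxb : r ≤ ‖x - b‖ := by
    rw [← dist_eq_norm]; exact infDist_le_dist_of_mem hb
  have hxb0 : 0 < ‖x - b‖ := hx0.trans_le hxb
  refine ⟨by rwa [hd], by rwa [hd], ?_⟩
  rw [hd, hyb, dist_eq_norm]
  rw [lt_div_iff₀ hxb0] at h1
  have h2 : inner ℝ (x + h • u - b) (x - b) ≤ ‖x + h • u - b‖ * ‖x - b‖ := real_inner_le_norm _ _
  have h3 : inner ℝ (x + h • u - b) (x - b) = ‖x - b‖ ^ 2 + h * inner ℝ u (x - b) := by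
    rw [show x + h • u - b = (x - b) + h • u by abel, inner_add_left, real_inner_self_eq_norm_sq,
      real_inner_smul_left]
  have h4 : (‖x - b‖ + (1 - η) * h) * ‖x - b‖ ≤ ‖x + h • u - b‖ * ‖x - b‖ := by nlinarith
  have := le_of_mul_le_mul_right h4 hxb0
  linarith

/-- A variational argument replaces the gradient flow of the distance. A maximizer of `infDist · M -
(1 - η) * dist · x` on the ball of radius `s` must lie on the sphere, since elsewhere growth at rate
`1 - η/2` beats the penalty; then `η` tends to `0`. -/
theorem exists_infDist_add_le [FiniteDimensional ℝ F] {M : Set F} (hM : IsCompact M)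
    (hne : M.Nonempty) {τ : ℝ} (hU : UniqueNearest τ M) {x : F} (hx0 : 0 < infDist x M)
    {s : ℝ} (hs : 0 ≤ s) (hsτ : infDist x M + s < τ) :
    ∃ y, dist y x ≤ s ∧ infDist x M + s ≤ infDist y M := by
  have hK : IsCompact (closedBall x s) := isCompact_closedBall x s
  have hKne : (closedBall x s).Nonempty := ⟨x, mem_closedBall_self hs⟩
  have hc : Continuous fun y => infDist y M := continuous_infDist_pt M
  obtain ⟨y, hy, hmax⟩ := hK.exists_isMaxOn hKne hc.continuousOn
  refine ⟨y, hy, ?_⟩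
  have key : ∀ η : ℝ, 0 < η → η ≤ 1 → infDist x M + (1 - η) * s ≤ infDist y M := by
    intro η hη hη1
    have hc' : Continuous fun y => infDist y M - (1 - η) * dist y x := by fun_prop
    obtain ⟨z, hz, hzmax⟩ := hK.exists_isMaxOn hKne hc'.continuousOn
    have hzs : dist z x ≤ s := hz
    have hzx : infDist x M ≤ infDist z M - (1 - η) * dist z x := by
      have := hzmax (mem_closedBall_self hs)
      simpa using this
    have hzτ : infDist z M < τ := by
      have := infDist_le_infDist_add_dist (s := M) (x := z) (y := x)
      linarith
    rcases hzs.eq_or_lt with heq | hlt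
    · have h1 : infDist z M ≤ infDist y M := hmax hz
      rw [heq] at hzx; linarith
    · exfalso
      have hz0 : 0 < infDist z M := by
        have : 0 ≤ (1 - η) * dist z x := mul_nonneg (by linarith) dist_nonneg
        linarith
      obtain ⟨z', h0, h1, h2⟩ := exists_infDist_growth hM hne hU hz0 hzτ (half_pos hη)
        (sub_pos.2 hlt)
      have htri := dist_triangle z' z x
      have hz' : z' ∈ closedBall x s := by
        rw [mem_closedBall]; linarith
      have h3 : infDist z' M - (1 - η) * dist z' x ≤ infDist z M - (1 - η) * dist z x :=
        hzmax hz'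
      nlinarith
  refine le_of_forall_pos_le_add fun e he => ?_
  -- This `η` is at most `1` and makes the loss `η * s` at most `e`.
  have := key (e / (s + e)) (by positivity) (by rw [div_le_one (by positivity)]; linarith)
  have h2 : e / (s + e) * s ≤ e := by
    rw [div_mul_eq_mul_div, div_le_iff₀ (by positivity)]; nlinarith
  linarith

/-- The point `y` found above is within `s` of `p + t • w` and at least `t + s` from `p`. This is
the equality case of the triangle inequality, so `y` lies on the ray from `p` in direction `w`. -/
theorem le_infDist_add_smul [FiniteDimensional ℝ F] {M : Set F} (hM : IsCompact M)
    {τ : ℝ} (hU : UniqueNearest τ M) {p w : F} (hp : p ∈ M) (hw : ‖w‖ = 1) {t s : ℝ}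
    (ht : 0 < t) (hs : 0 ≤ s) (hts : t + s < τ) (h : infDist (p + t • w) M = t) :
    t + s ≤ infDist (p + (t + s) • w) M := by
  obtain ⟨y, hy, hle⟩ := exists_infDist_add_le hM ⟨p, hp⟩ hU (h ▸ ht) hs (by rwa [h])
  rw [h] at hle
  suffices y = p + (t + s) • w by rwa [this] at hle
  set e := y - (p + t • w) with he
  have he1 : ‖e‖ ≤ s := by rw [he, ← dist_eq_norm]; exact hy
  have he2 : t + s ≤ ‖e + t • w‖ := by
    have : e + t • w = y - p := by rw [he]; abel
    rw [this, ← dist_eq_norm]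
    exact hle.trans (infDist_le_dist_of_mem hp)
  have h1 : ‖e + t • w‖ ^ 2 = ‖e‖ ^ 2 + 2 * t * inner ℝ e w + t ^ 2 := by
    rw [norm_add_sq_real, real_inner_smul_right, norm_smul, hw, Real.norm_of_nonneg ht.le]; ring
  have h2 : ‖e - s • w‖ ^ 2 = ‖e‖ ^ 2 - 2 * s * inner ℝ e w + s ^ 2 := by
    rw [norm_sub_sq_real, real_inner_smul_right, norm_smul, hw, Real.norm_of_nonneg hs]; ring
  have h3 : ‖e‖ ^ 2 ≤ s ^ 2 := by gcongr
  have h4 : (t + s) ^ 2 ≤ ‖e + t • w‖ ^ 2 := by gcongr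
  have h5 : s ≤ inner ℝ e w := by
    by_contra! hcon
    nlinarith
  have h6 : ‖e - s • w‖ ^ 2 ≤ 0 := by nlinarith
  have h7 : e - s • w = 0 := norm_eq_zero.1 (by nlinarith [norm_nonneg (e - s • w)])
  have h8 : y = e + (p + t • w) := by rw [he]; abel
  rw [h8, sub_eq_zero.1 h7, add_smul]; abel

/-- Federer's inequality: below the reach, the local quadratic bound for a normal vector is
global. -/
theorem two_mul_inner_le_of_uniqueNearest [FiniteDimensional ℝ F] {M : Set F} (hM : IsCompact M)
    {τ : ℝ} (hτ : 0 < τ) (hU : UniqueNearest τ M) {p w : F} (hp : p ∈ M)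
    (hloc : ∃ C : ℝ, ∀ q ∈ M, inner ℝ w (q - p) ≤ C * ‖q - p‖ ^ 2) {q : F} (hq : q ∈ M) :
    2 * τ * inner ℝ w (q - p) ≤ ‖w‖ * ‖q - p‖ ^ 2 := by
  have hexp : ∀ (v : F) (t : ℝ) (q : F), ‖v‖ = 1 →
      dist (p + t • v) q ^ 2 = t ^ 2 - 2 * t * inner ℝ v (q - p) + ‖q - p‖ ^ 2 := by
    intro v t q hv
    rw [dist_eq_norm, show p + t • v - q = t • v - (q - p) by abel, norm_sub_sq_real, norm_smul, hv,
      real_inner_smul_left, mul_one, Real.norm_eq_abs, sq_abs]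
    ring
  have unit : ∀ v : F, ‖v‖ = 1 → (∃ C : ℝ, ∀ q ∈ M, inner ℝ v (q - p) ≤ C * ‖q - p‖ ^ 2) →
      2 * τ * inner ℝ v (q - p) ≤ ‖q - p‖ ^ 2 := by
    rintro v hv ⟨C, hC⟩
    -- With `2 * t * C ≤ 1`, the local bound makes `p` a nearest point of `p + t • v`. The ray can
    -- then be prolonged to every length below `τ`.
    obtain ⟨t, ht0, htτ, htC⟩ : ∃ t : ℝ, 0 < t ∧ t < τ ∧ 2 * t * C ≤ 1 := by
      refine ⟨min (τ / 2) (1 / (2 * (|C| + 1))), by positivity, ?_, ?_⟩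
      · exact (min_le_left _ _).trans_lt (by linarith)
      · have h1 : min (τ / 2) (1 / (2 * (|C| + 1))) ≤ 1 / (2 * (|C| + 1)) := min_le_right _ _
        have h0 : 0 < min (τ / 2) (1 / (2 * (|C| + 1))) := by positivity
        rw [le_div_iff₀ (by positivity)] at h1
        nlinarith [le_abs_self C]
    have hinf : infDist (p + t • v) M = t := by
      refine le_antisymm ?_ ?_
      · refine (infDist_le_dist_of_mem hp).trans_eq ?_
        rw [dist_eq_norm, add_sub_cancel_left, norm_smul, hv, mul_one, Real.norm_of_nonneg ht0.le]
      · refine (le_infDist ⟨p, hp⟩).2 fun q hq => ?_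
        refine le_of_sq_le_sq ?_ dist_nonneg
        rw [hexp v t q hv]
        have := hC q hq
        nlinarith [sq_nonneg ‖q - p‖]
    have main : ∀ s, 0 ≤ s → t + s < τ → 2 * (t + s) * inner ℝ v (q - p) ≤ ‖q - p‖ ^ 2 := by
      intro s hs hsτ
      have h1 := le_infDist_add_smul hM hU hp hv ht0 hs hsτ hinf
      have h2 := h1.trans (infDist_le_dist_of_mem hq)
      have h3 : (t + s) ^ 2 ≤ dist (p + (t + s) • v) q ^ 2 := by gcongr
      rw [hexp v _ q hv] at h3
      linarith
    have hlim : Tendsto (fun s => 2 * s * inner ℝ v (q - p)) (𝓝[<] τ)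
        (𝓝 (2 * τ * inner ℝ v (q - p))) := by
      have : Continuous fun s => 2 * s * inner ℝ v (q - p) := by fun_prop
      exact (this.tendsto τ).mono_left nhdsWithin_le_nhds
    refine le_of_tendsto hlim ?_
    filter_upwards [Ioo_mem_nhdsLT htτ] with s hs
    simpa using main (s - t) (by linarith [hs.1]) (by linarith [hs.2])
  rcases eq_or_ne w 0 with rfl | hw
  · simp
  · have hw0 : 0 < ‖w‖ := norm_pos_iff.2 hw
    obtain ⟨C, hC⟩ := hloc
    have h := unit (‖w‖⁻¹ • w) (by rw [norm_smul, norm_inv, norm_norm, inv_mul_cancel₀ hw0.ne'])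
      ⟨‖w‖⁻¹ * C, fun q hq => by
        rw [real_inner_smul_left, mul_assoc]
        exact mul_le_mul_of_nonneg_left (hC q hq) (by positivity)⟩
    rw [real_inner_smul_left] at h
    have h2 := mul_le_mul_of_nonneg_left h hw0.le
    calc 2 * τ * inner ℝ w (q - p) = ‖w‖ * (2 * τ * (‖w‖⁻¹ * inner ℝ w (q - p))) := by
          field_simp
      _ ≤ _ := h2

end Reach

/-! ### First and second order conditions in charts of a submanifold. -/

section Charts

open Filter Topology Metric

variable {E F : Type*} [NormedAddCommGroup E] [NormedSpace ℝ E]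
  [NormedAddCommGroup F] [InnerProductSpace ℝ F]

/-- First and second order conditions at a maximum of `⟪w, · - p⟫ - c ‖· - p‖ ^ 2` on the image
of `φ`. -/
theorem inner_fderiv_eq_zero_and_inner_fderiv_fderiv_le {φ : E → F} {x : E} {w : F} {c : ℝ}
    (hφ : ContDiffAt ℝ 2 φ x)
    (h : ∀ᶠ y in 𝓝 x, inner ℝ w (φ y - φ x) ≤ c * ‖φ y - φ x‖ ^ 2) (a : E) :
    inner ℝ w (fderiv ℝ φ x a) = 0 ∧
      inner ℝ w (fderiv ℝ (fderiv ℝ φ) x a a) ≤ 2 * c * ‖fderiv ℝ φ x a‖ ^ 2 := by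
  set l : ℝ → E := fun s => x + s • a with hl
  have hl0 : l 0 = x := by simp [hl]
  have hlc : Tendsto l (𝓝 0) (𝓝 x) := by
    have : Continuous l := by fun_prop
    simpa [hl0] using this.tendsto 0
  have hld : ∀ s, HasDerivAt l a s := fun s => by
    exact (((hasDerivAt_id s).smul_const a).const_add x).congr_deriv (one_smul ℝ a)
  set g : ℝ → ℝ := fun s => inner ℝ w (φ (l s) - φ x) - c * ‖φ (l s) - φ x‖ ^ 2 with hg
  have hmax : IsLocalMax g 0 := by
    filter_upwards [hlc.eventually h] with s hs
    simp only [hg, hl0, sub_self, inner_zero_right, norm_zero]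
    linarith
  have hev : ∀ᶠ y in 𝓝 x, ContDiffAt ℝ 2 φ y := hφ.eventually (by simp)
  set g' : ℝ → ℝ := fun s => inner ℝ w (fderiv ℝ φ (l s) a) -
    c * (2 * inner ℝ (φ (l s) - φ x) (fderiv ℝ φ (l s) a)) with hg'
  have hderiv : ∀ᶠ s in 𝓝 (0 : ℝ), HasDerivAt g (g' s) s := by
    filter_upwards [hlc.eventually hev] with s hs
    have h1 : HasDerivAt (fun s => φ (l s) - φ x) (fderiv ℝ φ (l s) a) s :=
      ((hs.differentiableAt (by norm_num)).hasFDerivAt.comp_hasDerivAt s (hld s)).sub_const _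
    have h2 := ((hasDerivAt_const s w).inner ℝ h1).sub (h1.norm_sq.const_mul c)
    refine h2.congr_deriv ?_
    simp [hg']
  have hd1 : HasDerivAt (fun s => fderiv ℝ φ (l s) a) (fderiv ℝ (fderiv ℝ φ) x a a) 0 := by
    have h1 : ContDiffAt ℝ 1 (fderiv ℝ φ) (l 0) := by
      rw [hl0]; exact hφ.fderiv_right (by norm_num)
    have h2 := (h1.differentiableAt (by norm_num)).hasFDerivAt.comp_hasDerivAt (0 : ℝ) (hld 0)
    rw [hl0] at h2
    have h3 := h2.clm_apply (hasDerivAt_const (0 : ℝ) a)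
    simpa using h3
  have hd0 : HasDerivAt (fun s => φ (l s) - φ x) (fderiv ℝ φ x a) 0 := by
    have h1 : HasFDerivAt φ (fderiv ℝ φ x) (l 0) := by
      rw [hl0]; exact (hφ.differentiableAt (by norm_num)).hasFDerivAt
    exact (h1.comp_hasDerivAt (0 : ℝ) (hld 0)).sub_const _
  have hderiv2 : HasDerivAt g'
      (inner ℝ w (fderiv ℝ (fderiv ℝ φ) x a a) - 2 * c * ‖fderiv ℝ φ x a‖ ^ 2) 0 := by
    have h1 := ((hasDerivAt_const (0 : ℝ) w).inner ℝ hd1).sub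
      (((hd0.inner ℝ hd1).const_mul 2).const_mul c)
    refine h1.congr_deriv ?_
    simp [hl0]
    ring
  have hg'eq : deriv g =ᶠ[𝓝 0] g' := hderiv.mono fun s hs => hs.deriv
  have hfirst : g' 0 = 0 := by
    rw [← hg'eq.self_of_nhds]; exact hmax.deriv_eq_zero
  refine ⟨by simpa [hg', hl0] using hfirst, ?_⟩
  have hdd : deriv (deriv g) 0 =
      inner ℝ w (fderiv ℝ (fderiv ℝ φ) x a a) - 2 * c * ‖fderiv ℝ φ x a‖ ^ 2 := by
    rw [hg'eq.deriv_eq, hderiv2.deriv]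
  -- A positive second derivative would make `0` a local minimum as well as a local maximum, so `g`
  -- would be locally constant and its second derivative zero.
  by_contra! hcon
  have hpos : 0 < deriv (deriv g) 0 := by rw [hdd]; linarith
  have hmin := isLocalMin_of_deriv_deriv_pos hpos hmax.deriv_eq_zero
    hderiv.self_of_nhds.continuousAt
  have hconst : g =ᶠ[𝓝 0] fun _ => g 0 := by
    filter_upwards [hmax, hmin] with s h1 h2 using le_antisymm h1 h2
  have h0 : deriv (deriv g) 0 = 0 := by
    have : deriv g =ᶠ[𝓝 0] fun _ => 0 := by
      simpa using hconst.deriv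
    simpa using this.deriv_eq
  exact hpos.ne' h0

/-- Since `w` kills the linear term, only the Taylor remainder counts. It is quadratic in `y - x`,
and injectivity of the derivative gives `‖y - x‖ ≤ 2 * k * ‖φ y - φ x‖` near `x`. -/
theorem exists_eventually_inner_le [FiniteDimensional ℝ E] {φ : E → F} {x : E} {w : F}
    (hφ : ContDiffAt ℝ 2 φ x) (hinj : Function.Injective (fderiv ℝ φ x))
    (hw : ∀ a, inner ℝ w (fderiv ℝ φ x a) = 0) :
    ∃ C : ℝ, ∀ᶠ y in 𝓝 x, inner ℝ w (φ y - φ x) ≤ C * ‖φ y - φ x‖ ^ 2 := by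
  have hφ1 : ContDiffAt ℝ 1 (fderiv ℝ φ) x := hφ.fderiv_right (by norm_num)
  obtain ⟨K, t, ht, hK⟩ := hφ1.exists_lipschitzOnWith
  have hev : ∀ᶠ y in 𝓝 x, ContDiffAt ℝ 2 φ y := hφ.eventually (by simp)
  obtain ⟨r, hr, hball⟩ := Metric.eventually_nhds_iff_ball.1 (hev.and (show ∀ᶠ y in 𝓝 x, y ∈ t from ht))
  have hxt : x ∈ t := mem_of_mem_nhds ht
  have hquad : ∀ y ∈ ball x r, ‖φ y - φ x - fderiv ℝ φ x (y - x)‖ ≤ K * ‖y - x‖ * ‖y - x‖ := by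
    intro y hy
    have hsub : closedBall x ‖y - x‖ ⊆ ball x r :=
      closedBall_subset_ball (by rwa [← dist_eq_norm])
    refine (convex_closedBall x ‖y - x‖).norm_image_sub_le_of_norm_hasFDerivWithin_le'
      (fun z hz => ((hball z (hsub hz)).1.differentiableAt (by norm_num)).hasFDerivAt.hasFDerivWithinAt)
      (fun z hz => ?_) (mem_closedBall_self (norm_nonneg _))
      (by rw [mem_closedBall, dist_eq_norm])
    rw [← dist_eq_norm]
    refine (hK.dist_le_mul z (hball z (hsub hz)).2 x hxt).trans ?_
    exact mul_le_mul_of_nonneg_left hz K.2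
  obtain ⟨k, hk, hanti⟩ := LinearMap.exists_antilipschitzWith (fderiv ℝ φ x).toLinearMap
    (LinearMap.ker_eq_bot.2 hinj)
  have hk' : (0 : ℝ) < k := hk
  have hlow : ∀ v, ‖v‖ ≤ k * ‖fderiv ℝ φ x v‖ := fun v => by
    simpa using hanti.le_mul_norm_sub v 0
  refine ⟨‖w‖ * K * (2 * k) ^ 2, ?_⟩
  have hsmall : ∀ᶠ y in 𝓝 x, k * K * ‖y - x‖ ≤ 1 / 2 := by
    have : Tendsto (fun y => k * K * ‖y - x‖) (𝓝 x) (𝓝 0) := by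
      have hc : Continuous fun y => k * K * ‖y - x‖ := by fun_prop
      simpa using hc.tendsto x
    exact this.eventually (ge_mem_nhds (by norm_num))
  filter_upwards [hsmall, ball_mem_nhds x hr] with y hy hyr
  have h1 := hquad y hyr
  have h2 : ‖fderiv ℝ φ x (y - x)‖ ≤ ‖φ y - φ x‖ + K * ‖y - x‖ * ‖y - x‖ := by
    have := norm_sub_norm_le (fderiv ℝ φ x (y - x)) (φ y - φ x)
    rw [norm_sub_rev (fderiv ℝ φ x (y - x))] at this
    linarith
  have h3 : ‖y - x‖ ≤ 2 * k * ‖φ y - φ x‖ := by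
    have h4 := hlow (y - x)
    have h5 := mul_le_mul_of_nonneg_left h2 hk'.le
    have h6 := mul_le_mul_of_nonneg_right hy (norm_nonneg (y - x))
    nlinarith
  calc inner ℝ w (φ y - φ x) = inner ℝ w (φ y - φ x - fderiv ℝ φ x (y - x)) := by
        rw [inner_sub_right _ (φ y - φ x), hw, sub_zero]
    _ ≤ ‖w‖ * ‖φ y - φ x - fderiv ℝ φ x (y - x)‖ := real_inner_le_norm _ _
    _ ≤ ‖w‖ * (K * ‖y - x‖ * ‖y - x‖) := by gcongr
    _ = ‖w‖ * K * ‖y - x‖ ^ 2 := by ring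
    _ ≤ ‖w‖ * K * (2 * k * ‖φ y - φ x‖) ^ 2 := by gcongr
    _ = _ := by ring

/-- `φ` parametrizes the relatively open subset `M ∩ U` of `M` by the open set `V`. -/
structure IsChart (M U : Set F) (V : Set E) (φ : E → F) : Prop where
  isOpen_target : IsOpen U
  isOpen_source : IsOpen V
  contDiffOn : ContDiffOn ℝ 2 φ V
  injective_fderiv : ∀ x ∈ V, Function.Injective (fderiv ℝ φ x)
  isEmbedding : Topology.IsEmbedding (V.domRestrict φ)
  image_eq : φ '' V = M ∩ U

namespace IsChart

variable {M U : Set F} {V : Set E} {φ : E → F}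

theorem contDiffAt (h : IsChart M U V φ) {x : E} (hx : x ∈ V) : ContDiffAt ℝ 2 φ x :=
  h.contDiffOn.contDiffAt (h.isOpen_source.mem_nhds hx)

theorem injOn (h : IsChart M U V φ) : Set.InjOn φ V := by
  intro x hx y hy hxy
  exact congrArg Subtype.val (h.isEmbedding.injective (a₁ := ⟨x, hx⟩) (a₂ := ⟨y, hy⟩) hxy)

theorem apply_mem (h : IsChart M U V φ) {x : E} (hx : x ∈ V) : φ x ∈ M :=
  (h.image_eq.le (Set.mem_image_of_mem φ hx)).1

theorem exists_restrict (h : IsChart M U V φ) {V' : Set E} (hV' : IsOpen V') (hsub : V' ⊆ V) :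
    ∃ U', IsChart M U' V' φ := by
  obtain ⟨O, hO, hOV⟩ := h.isEmbedding.isInducing.isOpen_iff.1
    (hV'.preimage (continuous_subtype_val : Continuous (Subtype.val : V → E)))
  have hmem : ∀ x ∈ V, φ x ∈ O ↔ x ∈ V' := fun x hx => Set.ext_iff.1 hOV ⟨x, hx⟩
  refine ⟨U ∩ O, h.isOpen_target.inter hO, hV', h.contDiffOn.mono hsub,
    fun x hx => h.injective_fderiv x (hsub hx), ?_, ?_⟩
  · exact h.isEmbedding.comp (Topology.IsEmbedding.inclusion hsub)
  · rw [← Set.inter_assoc, ← h.image_eq]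
    ext q
    constructor
    · rintro ⟨x, hx, rfl⟩
      exact ⟨⟨x, hsub hx, rfl⟩, (hmem x (hsub hx)).2 hx⟩
    · rintro ⟨⟨x, hx, rfl⟩, hq⟩
      exact ⟨x, (hmem x hx).1 hq, rfl⟩

theorem eventually_nhdsWithin (h : IsChart M U V φ) {x : E} (hx : x ∈ V) {P : F → Prop}
    (hP : ∀ᶠ y in 𝓝 x, P (φ y)) : ∀ᶠ q in 𝓝[M] (φ x), P q := by
  have h1 : ∀ᶠ y : V in 𝓝 ⟨x, hx⟩, P (V.domRestrict φ y) :=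
    (continuous_subtype_val.tendsto (⟨x, hx⟩ : V)).eventually hP
  rw [h.isEmbedding.nhds_eq_comap, eventually_comap] at h1
  rw [eventually_nhdsWithin_iff]
  have hxU : φ x ∈ U := (h.image_eq.le (Set.mem_image_of_mem φ hx)).2
  filter_upwards [h1, h.isOpen_target.mem_nhds hxU] with q hq hqU hqM
  obtain ⟨y, hy, rfl⟩ := h.image_eq.ge ⟨hqM, hqU⟩
  exact hq ⟨y, hy⟩ rfl

theorem eventually_mem (h : IsChart M U V φ) {x : E} (hx : x ∈ V) : ∀ᶠ y in 𝓝 x, φ y ∈ M := by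
  filter_upwards [h.isOpen_source.mem_nhds hx] with y hy using h.apply_mem hy

theorem inner_conditions (h : IsChart M U V φ) {x : E} (hx : x ∈ V) {w : F} {c : ℝ}
    (hw : ∀ q ∈ M, inner ℝ w (q - φ x) ≤ c * ‖q - φ x‖ ^ 2) (a : E) :
    inner ℝ w (fderiv ℝ φ x a) = 0 ∧
      inner ℝ w (fderiv ℝ (fderiv ℝ φ) x a a) ≤ 2 * c * ‖fderiv ℝ φ x a‖ ^ 2 :=
  inner_fderiv_eq_zero_and_inner_fderiv_fderiv_le (h.contDiffAt hx)
    ((h.eventually_mem hx).mono fun _ hy => hw _ hy) a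

/-- At distance at least `δ` from `φ x`, Cauchy–Schwarz already gives a quadratic bound with
constant `‖w‖ / δ`, so the local estimate becomes global. -/
theorem exists_inner_le [FiniteDimensional ℝ E] (h : IsChart M U V φ) {x : E} (hx : x ∈ V) {w : F}
    (hw : ∀ a, inner ℝ w (fderiv ℝ φ x a) = 0) :
    ∃ C : ℝ, ∀ q ∈ M, inner ℝ w (q - φ x) ≤ C * ‖q - φ x‖ ^ 2 := by
  obtain ⟨C, hC⟩ := exists_eventually_inner_le (h.contDiffAt hx) (h.injective_fderiv x hx) hw
  have hC' := h.eventually_nhdsWithin hx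
    (P := fun q => inner ℝ w (q - φ x) ≤ C * ‖q - φ x‖ ^ 2) hC
  rw [eventually_nhdsWithin_iff, Metric.eventually_nhds_iff_ball] at hC'
  obtain ⟨δ, hδ, hball⟩ := hC'
  refine ⟨max C (‖w‖ / δ), fun q hq => ?_⟩
  by_cases hqδ : q ∈ ball (φ x) δ
  · exact (hball q hqδ hq).trans (by gcongr; exact le_max_left _ _)
  · have hle : δ ≤ ‖q - φ x‖ := by
      rw [mem_ball, not_lt, dist_eq_norm] at hqδ; exact hqδ
    calc inner ℝ w (q - φ x) ≤ ‖w‖ * ‖q - φ x‖ := real_inner_le_norm _ _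
      _ = ‖w‖ / δ * (δ * ‖q - φ x‖) := by field_simp
      _ ≤ ‖w‖ / δ * (‖q - φ x‖ * ‖q - φ x‖) := by gcongr
      _ = ‖w‖ / δ * ‖q - φ x‖ ^ 2 := by ring
      _ ≤ _ := by gcongr; exact le_max_right _ _

/-- The quadratic bounds for `w` and `-w` make `⟪w, d n⟫` of second order in the increments `d n`,
so it vanishes after the rescaling that defines a tangent vector. -/
theorem inner_tangentCone_eq_zero [FiniteDimensional ℝ E] (h : IsChart M U V φ) {x : E}
    (hx : x ∈ V) {w : F} (hw : ∀ a, inner ℝ w (fderiv ℝ φ x a) = 0) {y : F}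
    (hy : y ∈ tangentConeAt ℝ M (φ x)) : inner ℝ w y = 0 := by
  have hle : ∀ w : F, (∀ a, inner ℝ w (fderiv ℝ φ x a) = 0) →
      ∃ C : ℝ, 0 ≤ C ∧ ∀ q ∈ M, inner ℝ w (q - φ x) ≤ C * ‖q - φ x‖ ^ 2 := fun w hw => by
    obtain ⟨C, hC⟩ := h.exists_inner_le hx hw
    exact ⟨|C|, abs_nonneg C, fun q hq => (hC q hq).trans (by gcongr; exact le_abs_self C)⟩
  obtain ⟨C₁, hC₁, h₁⟩ := hle w hw
  obtain ⟨C₂, hC₂, h₂⟩ := hle (-w) fun a => by rw [inner_neg_left, hw, neg_zero]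
  obtain ⟨α, l, hl, c, d, hd, hdM, hcd⟩ := exists_fun_of_mem_tangentConeAt hy
  have hbound : ∀ᶠ n in l, ‖inner ℝ w (c n • d n)‖ ≤ (C₁ + C₂) * (‖c n • d n‖ * ‖d n‖) := by
    filter_upwards [hdM] with n hn
    have e1 := h₁ _ hn
    have e2 := h₂ _ hn
    rw [add_sub_cancel_left] at e1 e2
    rw [inner_neg_left] at e2
    have e3 : |inner ℝ w (d n)| ≤ (C₁ + C₂) * ‖d n‖ ^ 2 := by
      rw [abs_le]; constructor <;> nlinarith [sq_nonneg ‖d n‖]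
    rw [real_inner_smul_right, norm_mul, norm_smul, Real.norm_eq_abs (inner ℝ w (d n))]
    calc ‖c n‖ * |inner ℝ w (d n)| ≤ ‖c n‖ * ((C₁ + C₂) * ‖d n‖ ^ 2) := by gcongr
      _ = _ := by ring
  have hlim : Tendsto (fun n => (C₁ + C₂) * (‖c n • d n‖ * ‖d n‖)) l (𝓝 0) := by
    simpa using (hcd.norm.mul hd.norm).const_mul (C₁ + C₂)
  have h0 := squeeze_zero_norm' hbound hlim
  have h1 : Tendsto (fun n => inner ℝ w (c n • d n)) l (𝓝 (inner ℝ w y)) :=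
    (tendsto_const_nhds (x := w)).inner hcd
  exact tendsto_nhds_unique h1 h0

end IsChart

theorem IsChart.mem_normalSpace [FiniteDimensional ℝ E] {M U : Set (EuclideanSpace ℝ (Fin D))}
    {V : Set E} {φ : E → EuclideanSpace ℝ (Fin D)} (h : IsChart M U V φ) {x : E}
    (hx : x ∈ V) {w : EuclideanSpace ℝ (Fin D)} (hw : ∀ a, inner ℝ w (fderiv ℝ φ x a) = 0) :
    w ∈ normalSpace M (φ x) := by
  rw [normalSpace, Submodule.mem_orthogonal']
  intro u hu
  rw [tangentSpace] at hu
  induction hu using Submodule.span_induction with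
  | mem y hy => exact h.inner_tangentCone_eq_zero hx hw hy
  | zero => exact inner_zero_right _
  | add y z _ _ hy hz => rw [inner_add_right, hy, hz, add_zero]
  | smul a y _ hy => rw [real_inner_smul_right, hy, mul_zero]

theorem IsC21Submanifold.exists_isChart {d : ℕ} {M : Set (EuclideanSpace ℝ (Fin D))}
    (hM : IsC21Submanifold d M) {p : EuclideanSpace ℝ (Fin D)} (hp : p ∈ M) :
    ∃ (U : Set (EuclideanSpace ℝ (Fin D))) (V : Set (EuclideanSpace ℝ (Fin d)))
      (φ : EuclideanSpace ℝ (Fin d) → EuclideanSpace ℝ (Fin D)),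
      IsChart M U V φ ∧ ∃ x ∈ V, φ x = p := by
  obtain ⟨U, V, φ, hU, hpU, hV, hφ, -, hinj, hemb, himg⟩ := hM p hp
  exact ⟨U, V, φ, ⟨hU, hV, hφ, hinj, hemb, himg⟩, himg.ge ⟨hp, hpU⟩⟩

end Charts

/-! ### Parametrization of the normal bundle and its Jacobian. -/

section NormalParametrization

open Filter Topology Metric
open ContinuousLinearMap (adjoint)

variable {E F : Type*} [NormedAddCommGroup E] [InnerProductSpace ℝ E] [FiniteDimensional ℝ E]
  [NormedAddCommGroup F] [InnerProductSpace ℝ F] [FiniteDimensional ℝ F]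

/-- The operator adjoint on a real inner product space, as a linear map. -/
noncomputable def adjointCLM : (E →L[ℝ] F) →L[ℝ] (F →L[ℝ] E) :=
  LinearMap.toContinuousLinearMap
    { toFun := fun A => adjoint A
      map_add' := fun A B => map_add _ A B
      map_smul' := fun c A => by simp }

@[simp]
theorem adjointCLM_apply (A : E →L[ℝ] F) :
    adjointCLM A = adjoint A := rfl

/-- `u ↦ (Aᵀ u, P u)` with `P` the orthogonal projection to `W`. -/
noncomputable def frameMap (W : Submodule ℝ F) (A : E →L[ℝ] F) : F →L[ℝ] E × W :=
  (adjointCLM A).prod W.orthogonalProjectionOnto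

/-- Linear parametrization by `W` of the orthogonal complement of the range of `A`. -/
noncomputable def normalParam (W : Submodule ℝ F) (A : E →L[ℝ] F) : W →L[ℝ] F :=
  (frameMap W A).inverse.comp (ContinuousLinearMap.inr ℝ E W)

/-- The parametrization of the normal bundle over a chart `φ`. -/
noncomputable def bundleParam (W : Submodule ℝ F) (φ : E → F) (z : E × W) : F :=
  normalParam W (fderiv ℝ φ z.1) z.2

variable {W : Submodule ℝ F} {A : E →L[ℝ] F}

theorem frameMap_normalParam (h : (frameMap W A).IsInvertible) (y : W) :
    frameMap W A (normalParam W A y) = (0, y) := by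
  simp [normalParam, h.self_apply_inverse]

theorem inner_normalParam (h : (frameMap W A).IsInvertible) (y : W) (a : E) :
    inner ℝ (normalParam W A y) (A a) = 0 := by
  rw [← ContinuousLinearMap.adjoint_inner_left]
  have := congrArg Prod.fst (frameMap_normalParam h y)
  simp only [frameMap, ContinuousLinearMap.prod_apply, adjointCLM_apply] at this
  rw [this, inner_zero_left]

theorem orthogonalProjectionOnto_normalParam (h : (frameMap W A).IsInvertible) (y : W) :
    W.orthogonalProjectionOnto (normalParam W A y) = y :=
  congrArg Prod.snd (frameMap_normalParam h y)

theorem normalParam_orthogonalProjectionOnto (h : (frameMap W A).IsInvertible) {v : F}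
    (hv : ∀ a, inner ℝ v (A a) = 0) : normalParam W A (W.orthogonalProjectionOnto v) = v := by
  refine h.injective ?_
  rw [frameMap_normalParam h]
  refine Prod.ext ?_ rfl
  symm
  refine ext_inner_right ℝ fun a => ?_
  rw [inner_zero_left]
  exact (ContinuousLinearMap.adjoint_inner_left A a v).trans (hv a)

theorem normalParam_injective (h : (frameMap W A).IsInvertible) :
    Function.Injective (normalParam W A) := fun y z hyz => by
  rw [← orthogonalProjectionOnto_normalParam h y, hyz, orthogonalProjectionOnto_normalParam h]

theorem contDiff_frameMap : ContDiff ℝ 1 (frameMap W : (E →L[ℝ] F) → _) := by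
  have h : (frameMap W : (E →L[ℝ] F) → _) = fun A =>
      (ContinuousLinearMap.inl ℝ E W).comp (adjointCLM A) +
        (ContinuousLinearMap.inr ℝ E W).comp W.orthogonalProjectionOnto := by
    ext A u <;> simp [frameMap]
  rw [h]
  fun_prop

/-- The frame map at `A` is invertible if `W` is the orthogonal complement of the range of `A`. -/
theorem frameMap_isInvertible (hA : Function.Injective A) (hW : W = (LinearMap.range A.toLinearMap)ᗮ) :
    (frameMap W A).IsInvertible := by
  have hinj : Function.Injective (frameMap W A) := by
    rw [injective_iff_map_eq_zero]
    intro u hu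
    have h1 : adjoint A u = 0 := congrArg Prod.fst hu
    have h2 : W.orthogonalProjectionOnto u = 0 := congrArg Prod.snd hu
    rw [Submodule.orthogonalProjectionOnto_eq_zero_iff] at h2
    have h3 : u ∈ W := by
      rw [hW, Submodule.mem_orthogonal']
      rintro _ ⟨a, rfl⟩
      have := ContinuousLinearMap.adjoint_inner_left A a u
      rw [h1, inner_zero_left] at this
      exact this.symm
    exact inner_self_eq_zero.1 (h2 u h3)
  have hfr : Module.finrank ℝ F = Module.finrank ℝ (E × W) := by
    rw [Module.finrank_prod, hW, ← Submodule.finrank_add_finrank_orthogonal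
      (LinearMap.range A.toLinearMap), LinearMap.finrank_range_of_inj hA]
  exact ⟨(LinearMap.linearEquivOfInjective (frameMap W A).toLinearMap hinj
    hfr).toContinuousLinearEquiv, by ext u <;> rfl⟩

/-- Second fundamental form in the direction `v`, with `B` the second derivative of the chart. -/
noncomputable def shapeMap (B : E →L[ℝ] E →L[ℝ] F) (v : F) : E →L[ℝ] E :=
  LinearMap.toContinuousLinearMap
    { toFun := fun b => -(adjointCLM (B b) v)
      map_add' := fun a b => by simp [add_comm]
      map_smul' := fun c b => by simp }

theorem inner_shapeMap (B : E →L[ℝ] E →L[ℝ] F) (v : F) (a b : E) :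
    inner ℝ (shapeMap B v b) a = -inner ℝ v (B b a) := by
  change inner ℝ (-(adjoint (B b) v)) a = _
  rw [inner_neg_left, ContinuousLinearMap.adjoint_inner_left]

variable {φ : E → F} {x : E}

theorem differentiableAt_bundleParam (hφ : ContDiffAt ℝ 2 φ x)
    (hx : (frameMap W (fderiv ℝ φ x)).IsInvertible) (y : W) :
    DifferentiableAt ℝ (bundleParam W φ) (x, y) := by
  have h1 : ContDiffAt ℝ 1 (fun z : E × W => fderiv ℝ φ z.1) (x, y) :=
    (show ContDiffAt ℝ 1 (fderiv ℝ φ) (x, y).1 from hφ.fderiv_right (by norm_num)).comp (x, y) contDiffAt_fst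
  have h2 : ContDiffAt ℝ 1 (fun z : E × W => frameMap W (fderiv ℝ φ z.1)) (x, y) :=
    (contDiff_frameMap (E := E) (W := W)).contDiffAt.comp (x, y) h1
  have h3 : ContDiffAt ℝ 1 (fun z : E × W => (frameMap W (fderiv ℝ φ z.1)).inverse) (x, y) :=
    ContDiffAt.comp (f := fun z : E × W => frameMap W (fderiv ℝ φ z.1)) (x, y)
      hx.contDiffAt_map_inverse h2
  have h4 : ContDiffAt ℝ 1 (fun z : E × W => ((0 : E), z.2)) (x, y) := by fun_prop
  exact (h3.clm_apply h4).differentiableAt (by norm_num)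

theorem eventually_frameMap_isInvertible (hφ : ContDiffAt ℝ 2 φ x)
    (hx : (frameMap W (fderiv ℝ φ x)).IsInvertible) :
    ∀ᶠ x' in 𝓝 x, (frameMap W (fderiv ℝ φ x')).IsInvertible := by
  have h1 : ContDiffAt ℝ 1 (fderiv ℝ φ) x := hφ.fderiv_right (by norm_num)
  have h2 : ContinuousAt (fun x => frameMap W (fderiv ℝ φ x)) x :=
    (contDiff_frameMap (E := E) (W := W)).continuous.continuousAt.comp h1.continuousAt
  exact h2.eventually (ContinuousLinearEquiv.isOpen.mem_nhds hx)

/-- The derivative of the parametrization of the normal bundle, seen through the frame map, is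
block triangular with the second fundamental form as the first diagonal block. -/
theorem frameMap_fderiv_bundleParam (hφ : ContDiffAt ℝ 2 φ x)
    (hx : (frameMap W (fderiv ℝ φ x)).IsInvertible) (y : W) :
    (frameMap W (fderiv ℝ φ x)).comp (fderiv ℝ (bundleParam W φ) (x, y)) =
      (shapeMap (fderiv ℝ (fderiv ℝ φ) x) (bundleParam W φ (x, y))).prodMap
        (ContinuousLinearMap.id ℝ W) := by
  have hd := (differentiableAt_bundleParam hφ hx y).hasFDerivAt
  have hinv : ∀ᶠ z : E × W in 𝓝 (x, y), (frameMap W (fderiv ℝ φ z.1)).IsInvertible :=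
    (continuous_fst.tendsto (x, y)).eventually (eventually_frameMap_isInvertible hφ hx)
  -- `key1` and `key2` differentiate the two identities defining `bundleParam`: orthogonality to
  -- `fderiv ℝ φ z.1 a`, and projection to `W` equal to `z.2`.
  have key1 : ∀ (c : E × W) (a : E),
      inner ℝ (bundleParam W φ (x, y)) (fderiv ℝ (fderiv ℝ φ) x c.1 a) +
        inner ℝ (fderiv ℝ (bundleParam W φ) (x, y) c) (fderiv ℝ φ x a) = 0 := by
    intro c a
    have h1 : ContDiffAt ℝ 1 (fderiv ℝ φ) (x, y).1 := hφ.fderiv_right (by norm_num)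
    have h2 : HasFDerivAt (fun z : E × W => fderiv ℝ φ z.1)
        ((fderiv ℝ (fderiv ℝ φ) x).comp (ContinuousLinearMap.fst ℝ E W)) (x, y) :=
      (h1.differentiableAt (by norm_num)).hasFDerivAt.comp (x, y) hasFDerivAt_fst
    have h3 := h2.clm_apply (hasFDerivAt_const a (x, y))
    have h4 := hd.inner ℝ h3
    have h5 : (fun z : E × W => inner ℝ (bundleParam W φ z) (fderiv ℝ φ z.1 a)) =ᶠ[𝓝 (x, y)]
        fun _ => 0 := hinv.mono fun z hz => inner_normalParam hz _ _
    have h6 := h4.unique ((hasFDerivAt_const (0 : ℝ) (x, y)).congr_of_eventuallyEq h5)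
    simpa using congrArg (fun L => L c) h6
  have key2 : ∀ c : E × W,
      W.orthogonalProjectionOnto (fderiv ℝ (bundleParam W φ) (x, y) c) = c.2 := by
    intro c
    have h1 := (W.orthogonalProjectionOnto.hasFDerivAt (x := bundleParam W φ (x, y))).comp (x, y) hd
    have h2 : (fun z : E × W => W.orthogonalProjectionOnto (bundleParam W φ z)) =ᶠ[𝓝 (x, y)]
        fun z => z.2 := hinv.mono fun z hz => orthogonalProjectionOnto_normalParam hz _
    have h3 := h1.unique (hasFDerivAt_snd.congr_of_eventuallyEq h2)
    exact congrArg (fun L => L c) h3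
  refine ContinuousLinearMap.ext fun c => Prod.ext ?_ (key2 c)
  refine ext_inner_right ℝ fun a => ?_
  change inner ℝ (adjoint (fderiv ℝ φ x) _) a = inner ℝ (shapeMap _ _ c.1) a
  rw [ContinuousLinearMap.adjoint_inner_left, inner_shapeMap]
  exact eq_neg_of_add_eq_zero_right (key1 c a)

/-- The Jacobian factor of the parametrization of the normal bundle that depends on the base point
only. -/
noncomputable def baseDensity (W : Submodule ℝ F) (φ : E → F) (T₀ : F →L[ℝ] E × W) (x : E) : ℝ :=
  |(T₀.comp (frameMap W (fderiv ℝ φ x)).inverse).det| *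
    ((adjointCLM (fderiv ℝ φ x)).comp (fderiv ℝ φ x)).det

theorem det_fderiv_bundleParam (hφ : ContDiffAt ℝ 2 φ x)
    (hx : (frameMap W (fderiv ℝ φ x)).IsInvertible) (y : W) (T₀ : F →L[ℝ] E × W) :
    (T₀.comp (fderiv ℝ (bundleParam W φ) (x, y))).det =
      (T₀.comp (frameMap W (fderiv ℝ φ x)).inverse).det *
        (shapeMap (fderiv ℝ (fderiv ℝ φ) x) (bundleParam W φ (x, y))).det := by
  have h1 : fderiv ℝ (bundleParam W φ) (x, y) = (frameMap W (fderiv ℝ φ x)).inverse.comp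
      ((shapeMap (fderiv ℝ (fderiv ℝ φ) x) (bundleParam W φ (x, y))).prodMap
        (ContinuousLinearMap.id ℝ W)) := by
    rw [← frameMap_fderiv_bundleParam hφ hx y, ← ContinuousLinearMap.comp_assoc,
      hx.inverse_comp_self, ContinuousLinearMap.id_comp]
  rw [h1, ← ContinuousLinearMap.comp_assoc]
  set S := shapeMap (fderiv ℝ (fderiv ℝ φ) x) (bundleParam W φ (x, y))
  change LinearMap.det ((T₀.comp (frameMap W (fderiv ℝ φ x)).inverse).toLinearMap *
    (S.toLinearMap.prodMap LinearMap.id)) = _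
  rw [map_mul, LinearMap.det_prodMap, LinearMap.det_id, mul_one]

theorem continuousOn_baseDensity {V : Set E} (hV : ∀ x ∈ V, ContDiffAt ℝ 2 φ x)
    (hV' : ∀ x ∈ V, (frameMap W (fderiv ℝ φ x)).IsInvertible) (T₀ : F →L[ℝ] E × W) :
    ContinuousOn (baseDensity W φ T₀) V := by
  intro x hx
  refine ContinuousAt.continuousWithinAt ?_
  have h1 : ContinuousAt (fderiv ℝ φ) x :=
    ((hV x hx).fderiv_right (m := 1) (by norm_num)).continuousAt
  have h2 : ContinuousAt (fun x => frameMap W (fderiv ℝ φ x)) x :=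
    (contDiff_frameMap (E := E) (W := W)).continuous.continuousAt.comp h1
  have h3 : ContinuousAt (fun x => (frameMap W (fderiv ℝ φ x)).inverse) x :=
    ContinuousAt.comp (f := fun x => frameMap W (fderiv ℝ φ x))
      ((hV' x hx).contDiffAt_map_inverse (n := 1)).continuousAt h2
  have h4 : ContinuousAt (fun x => T₀.comp (frameMap W (fderiv ℝ φ x)).inverse) x :=
    continuousAt_const.clm_comp h3
  have h5 : ContinuousAt (fun x => (adjointCLM (fderiv ℝ φ x)).comp (fderiv ℝ φ x)) x :=
    (adjointCLM.continuous.continuousAt.comp h1).clm_comp h1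
  exact (ContinuousLinearMap.continuous_det.continuousAt.comp h4).abs.mul
    (ContinuousLinearMap.continuous_det.continuousAt.comp h5)

theorem shapeMap_isSymmetric (hφ : ContDiffAt ℝ 2 φ x) (v : F) :
    (shapeMap (fderiv ℝ (fderiv ℝ φ) x) v).toLinearMap.IsSymmetric := by
  intro a b
  change inner ℝ (shapeMap _ v a) b = inner ℝ a (shapeMap _ v b)
  rw [inner_shapeMap, real_inner_comm (shapeMap _ v b), inner_shapeMap,
    (hφ.isSymmSndFDerivAt (by simp)).eq a b]

theorem gram_isPositive (A : E →L[ℝ] F) :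
    ((adjointCLM A).comp A).toLinearMap.IsPositive := by
  constructor
  · intro a b
    change inner ℝ (adjoint A (A a)) b = inner ℝ a (adjoint A (A b))
    rw [ContinuousLinearMap.adjoint_inner_left, ContinuousLinearMap.adjoint_inner_right]
  · intro a
    change 0 ≤ inner ℝ (adjoint A (A a)) a
    rw [ContinuousLinearMap.adjoint_inner_left]
    exact real_inner_self_nonneg

theorem inner_gram (A : E →L[ℝ] F) (a : E) :
    inner ℝ ((adjointCLM A).comp A a) a = ‖A a‖ ^ 2 :=
  (ContinuousLinearMap.adjoint_inner_left A a (A a)).trans (real_inner_self_eq_norm_sq _)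

theorem gram_injective {A : E →L[ℝ] F} (hA : Function.Injective A) :
    Function.Injective ((adjointCLM A).comp A) := by
  rw [injective_iff_map_eq_zero]
  intro a ha
  have := inner_gram A a
  rw [ha, inner_zero_left] at this
  exact hA (by rw [map_zero]; exact norm_eq_zero.1 (pow_eq_zero_iff (two_ne_zero) |>.1 this.symm))

theorem shapeMap_isPositive (hφ : ContDiffAt ℝ 2 φ x) {v : F}
    (hv : ∀ a, inner ℝ v (fderiv ℝ (fderiv ℝ φ) x a a) ≤ 0) :
    (shapeMap (fderiv ℝ (fderiv ℝ φ) x) v).toLinearMap.IsPositive :=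
  ⟨shapeMap_isSymmetric hφ v, fun a => by
    change 0 ≤ inner ℝ (shapeMap _ v a) a
    rw [inner_shapeMap]; linarith [hv a]⟩

/-- The hypotheses place the second fundamental form between `0` and `c` times the Gram form, and
the determinant is monotone on that range. -/
theorem det_shapeMap_le (hφ : ContDiffAt ℝ 2 φ x) (hinj : Function.Injective (fderiv ℝ φ x)) {v : F}
    (hv : ∀ a, inner ℝ v (fderiv ℝ (fderiv ℝ φ) x a a) ≤ 0) {c : ℝ} (hc : 0 < c)
    (hv' : ∀ a, inner ℝ (-v) (fderiv ℝ (fderiv ℝ φ) x a a) ≤ c * ‖fderiv ℝ φ x a‖ ^ 2) :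
    |(shapeMap (fderiv ℝ (fderiv ℝ φ) x) v).det| ≤
      c ^ Module.finrank ℝ E * ((adjointCLM (fderiv ℝ φ x)).comp (fderiv ℝ φ x)).det := by
  have hP := shapeMap_isPositive hφ hv
  have hg := gram_isPositive (fderiv ℝ φ x)
  have hQ : (c • ((adjointCLM (fderiv ℝ φ x)).comp (fderiv ℝ φ x)).toLinearMap).IsPositive :=
    hg.smul_of_nonneg hc.le
  rw [abs_of_nonneg hP.det_nonneg]
  refine (hP.det_le_det hQ ?_ ⟨hQ.1.sub hP.1, fun a => ?_⟩).trans_eq (LinearMap.det_smul _ _)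
  · exact (smul_right_injective E hc.ne').comp (gram_injective hinj)
  · change 0 ≤ inner ℝ (c • ((adjointCLM (fderiv ℝ φ x)).comp (fderiv ℝ φ x) a) - shapeMap _ v a) a
    rw [inner_sub_left, inner_shapeMap, real_inner_smul_left, inner_gram]
    have := hv' a
    rw [inner_neg_left] at this
    linarith

theorem le_det_shapeMap (hφ : ContDiffAt ℝ 2 φ x) (hinj : Function.Injective (fderiv ℝ φ x)) {v : F}
    {c : ℝ} (hc : 0 < c)
    (hv : ∀ a, inner ℝ v (fderiv ℝ (fderiv ℝ φ) x a a) ≤ -c * ‖fderiv ℝ φ x a‖ ^ 2) :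
    c ^ Module.finrank ℝ E * ((adjointCLM (fderiv ℝ φ x)).comp (fderiv ℝ φ x)).det ≤
      |(shapeMap (fderiv ℝ (fderiv ℝ φ) x) v).det| := by
  have hP := shapeMap_isPositive hφ (v := v) fun a => (hv a).trans (by
    have := mul_nonneg hc.le (sq_nonneg ‖fderiv ℝ φ x a‖); linarith)
  have hg := gram_isPositive (fderiv ℝ φ x)
  have hQ : (c • ((adjointCLM (fderiv ℝ φ x)).comp (fderiv ℝ φ x)).toLinearMap).IsPositive :=
    hg.smul_of_nonneg hc.le
  refine le_trans ?_ (le_abs_self _)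
  refine (LinearMap.det_smul c _).symm.trans_le (hQ.det_le_det hP ?_ ⟨hP.1.sub hQ.1, fun a => ?_⟩)
  · rw [injective_iff_map_eq_zero]
    intro a ha
    have h1 : inner ℝ (shapeMap (fderiv ℝ (fderiv ℝ φ) x) v a) a = (0 : ℝ) := by
      rw [show shapeMap (fderiv ℝ (fderiv ℝ φ) x) v a = 0 from ha, inner_zero_left]
    rw [inner_shapeMap] at h1
    have h2 : c * ‖fderiv ℝ φ x a‖ ^ 2 ≤ 0 := by linarith [hv a]
    have h3 : ‖fderiv ℝ φ x a‖ ^ 2 = 0 :=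
      le_antisymm (nonpos_of_mul_nonpos_right h2 hc) (sq_nonneg _)
    exact hinj (by rw [map_zero]; exact norm_eq_zero.1 (pow_eq_zero_iff (two_ne_zero) |>.1 h3))
  · change 0 ≤ inner ℝ (shapeMap _ v a - c • ((adjointCLM (fderiv ℝ φ x)).comp (fderiv ℝ φ x) a)) a
    rw [inner_sub_left, inner_shapeMap, real_inner_smul_left, inner_gram]
    linarith [hv a]

end NormalParametrization

/-! ### Quadratic bounds for vectors in the normal cones. -/

section Cones

open Filter Topology Metric

theorem mem_normalCone_convexHull_iff {M : Set (EuclideanSpace ℝ (Fin D))}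
    {p v : EuclideanSpace ℝ (Fin D)} :
    v ∈ normalCone (convexHull ℝ M) p ↔ ∀ q ∈ M, inner ℝ v (q - p) ≤ 0 := by
  refine ⟨fun h q hq => h q (subset_convexHull ℝ M hq), fun h x hx => ?_⟩
  have hconv : Convex ℝ {x : EuclideanSpace ℝ (Fin D) | inner ℝ v x ≤ inner ℝ v p} :=
    convex_halfSpace_le (innerₛₗ ℝ v).isLinear _
  have := convexHull_min (fun q hq => by
    have := h q hq
    rw [inner_sub_right] at this
    exact sub_nonpos.1 this) hconv hx
  rw [inner_sub_right]
  exact sub_nonpos.2 this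

variable {d : ℕ} {M : Set (EuclideanSpace ℝ (Fin D))}

theorem inner_eq_zero_of_mem_normalCone {U : Set (EuclideanSpace ℝ (Fin D))}
    {V : Set (EuclideanSpace ℝ (Fin d))} {φ : EuclideanSpace ℝ (Fin d) → EuclideanSpace ℝ (Fin D)}
    (h : IsChart M U V φ) {x : EuclideanSpace ℝ (Fin d)} (hx : x ∈ V)
    {v : EuclideanSpace ℝ (Fin D)} (hv : v ∈ normalCone (convexHull ℝ M) (φ x))
    (a : EuclideanSpace ℝ (Fin d)) : inner ℝ v (fderiv ℝ φ x a) = 0 :=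
  (h.inner_conditions hx (w := v) (c := 0) (fun q hq => by
    simpa using mem_normalCone_convexHull_iff.1 hv q hq) a).1

/-- The negative of an outward normal vector in the unit ball satisfies Federer's inequality. -/
theorem inner_neg_le_of_mem_normalCone (hM : IsC21Submanifold d M) (hcomp : IsCompact M) {τ : ℝ}
    (hτ : 0 < τ) (hreach : ENNReal.ofReal τ ≤ reach M) {p v : EuclideanSpace ℝ (Fin D)} (hp : p ∈ M)
    (hv : v ∈ normalCone (convexHull ℝ M) p) (hv1 : ‖v‖ ≤ 1) {q : EuclideanSpace ℝ (Fin D)}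
    (hq : q ∈ M) : inner ℝ (-v) (q - p) ≤ 1 / (2 * τ) * ‖q - p‖ ^ 2 := by
  obtain ⟨U, V, φ, h, x, hx, rfl⟩ := hM.exists_isChart hp
  have h0 := inner_eq_zero_of_mem_normalCone h hx hv
  have h1 := two_mul_inner_le_of_uniqueNearest hcomp hτ (uniqueNearest_of_le_reach hreach) hp
    (h.exists_inner_le hx (w := -v) fun a => by rw [inner_neg_left, h0, neg_zero]) hq
  rw [norm_neg] at h1
  have h2 : ‖v‖ * ‖q - φ x‖ ^ 2 ≤ 1 * ‖q - φ x‖ ^ 2 := by gcongr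
  rw [div_mul_eq_mul_div, le_div_iff₀ (by positivity)]
  linarith

/-- A normal vector whose `ε`-neighborhood in the normal space lies in the normal cone of an
`R`-exposed submanifold exposes its base point quadratically. -/
theorem inner_le_of_ball_subset_normalCone (hM : IsC21Submanifold d M) {R ε : ℝ} (hR : 0 < R)
    (hε : 0 < ε) (hexp : IsExposed R M) {p v : EuclideanSpace ℝ (Fin D)} (hp : p ∈ M)
    (hv : ∀ w ∈ normalSpace M p, w ∈ ball 0 ε → v + w ∈ normalCone (convexHull ℝ M) p)
    {q : EuclideanSpace ℝ (Fin D)} (hq : q ∈ M) :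
    inner ℝ v (q - p) ≤ -(ε / (2 * R)) * ‖q - p‖ ^ 2 := by
  obtain ⟨U, V, φ, h, x, hx, rfl⟩ := hM.exists_isChart hp
  obtain ⟨z, hz, hpz⟩ := hexp (φ x) hp
  have hpz' : ‖φ x - z‖ = R := by rw [← dist_eq_norm]; exact hpz
  -- The outward unit normal of the exposing ball; expanding `‖q - z‖ ≤ R` around `φ x` gives `huq`.
  set u : EuclideanSpace ℝ (Fin D) := R⁻¹ • (φ x - z) with hu
  have hun : ‖u‖ = 1 := by
    rw [hu, norm_smul, hpz', Real.norm_of_nonneg (inv_nonneg.2 hR.le), inv_mul_cancel₀ hR.ne']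
  have huq : ∀ q ∈ M, inner ℝ u (q - φ x) ≤ -(1 / (2 * R)) * ‖q - φ x‖ ^ 2 := by
    intro q hq
    have h1 : ‖(q - φ x) + (φ x - z)‖ ≤ R := by
      have := hz hq
      rwa [mem_closedBall, dist_eq_norm, ← sub_add_sub_cancel q (φ x) z] at this
    have h2 : ‖(q - φ x) + (φ x - z)‖ ^ 2 ≤ R ^ 2 := by gcongr
    rw [norm_add_sq_real, hpz', real_inner_comm] at h2
    rw [hu, real_inner_smul_left]
    rw [show -(1 / (2 * R)) * ‖q - φ x‖ ^ 2 = R⁻¹ * (-(‖q - φ x‖ ^ 2 / 2)) by field_simp]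
    exact mul_le_mul_of_nonneg_left (by linarith) (inv_nonneg.2 hR.le)
  have huN : u ∈ normalCone (convexHull ℝ M) (φ x) :=
    mem_normalCone_convexHull_iff.2 fun q hq => (huq q hq).trans (by
      have : 0 ≤ 1 / (2 * R) * ‖q - φ x‖ ^ 2 := by positivity
      linarith)
  have huS : u ∈ normalSpace M (φ x) := h.mem_normalSpace hx (inner_eq_zero_of_mem_normalCone h hx huN)
  -- As `v - s • u` is in the cone, `⟪v, ·⟫` is dominated by `s * ⟪u, ·⟫` on `M - φ x`. The ball of
  -- radius `ε` is open, so `s = ε` is reached only in the limit.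
  have main : ∀ s, 0 < s → s < ε → inner ℝ v (q - φ x) ≤ -(s / (2 * R)) * ‖q - φ x‖ ^ 2 := by
    intro s hs hsε
    have h1 := mem_normalCone_convexHull_iff.1 (hv (-(s • u)) (Submodule.neg_mem _
      (Submodule.smul_mem _ s huS)) (by
        rw [mem_ball_zero_iff, norm_neg, norm_smul, hun, mul_one, Real.norm_of_nonneg hs.le]
        exact hsε)) q hq
    rw [inner_add_left, inner_neg_left, real_inner_smul_left] at h1
    have h2 := mul_le_mul_of_nonneg_left (huq q hq) hs.le
    calc inner ℝ v (q - φ x) ≤ s * inner ℝ u (q - φ x) := by linarith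
      _ ≤ _ := h2
      _ = _ := by ring
  have hlim : Tendsto (fun s => -(s / (2 * R)) * ‖q - φ x‖ ^ 2) (𝓝[<] ε)
      (𝓝 (-(ε / (2 * R)) * ‖q - φ x‖ ^ 2)) := by
    have : Continuous fun s => -(s / (2 * R)) * ‖q - φ x‖ ^ 2 := by fun_prop
    exact (this.tendsto ε).mono_left nhdsWithin_le_nhds
  refine ge_of_tendsto hlim ?_
  filter_upwards [Ioo_mem_nhdsLT hε] with s hs using main s hs.1 hs.2

/-- The strict bound at the given base point `p₀` makes it the only maximizer of `⟪v, ·⟫` on `M`, so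
any `p` whose cone contains `v` equals `p₀`. -/
theorem inner_le_of_mem_normalCone (hM : IsC21Submanifold d M) {R ε : ℝ} (hR : 0 < R)
    (hε : 0 < ε) (hexp : IsExposed R M) {v : EuclideanSpace ℝ (Fin D)}
    (hv : ∃ p ∈ M, ∀ w ∈ normalSpace M p, w ∈ ball 0 ε → v + w ∈ normalCone (convexHull ℝ M) p)
    {p : EuclideanSpace ℝ (Fin D)} (hp : p ∈ M) (hvp : v ∈ normalCone (convexHull ℝ M) p)
    {q : EuclideanSpace ℝ (Fin D)} (hq : q ∈ M) :
    inner ℝ v (q - p) ≤ -(ε / (2 * R)) * ‖q - p‖ ^ 2 := by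
  obtain ⟨p₀, hp₀, hv₀⟩ := hv
  have h1 := inner_le_of_ball_subset_normalCone hM hR hε hexp hp₀ hv₀ hp
  have h2 := mem_normalCone_convexHull_iff.1 hvp p₀ hp₀
  have h3 : inner ℝ v (p - p₀) = -inner ℝ v (p₀ - p) := by
    rw [← inner_neg_right, neg_sub]
  have h4 : 0 < ε / (2 * R) := by positivity
  have h5 : ‖p - p₀‖ ^ 2 = 0 :=
    le_antisymm (by by_contra! hc; nlinarith [mul_pos h4 hc]) (sq_nonneg _)
  have h6 : p = p₀ := sub_eq_zero.1 (norm_eq_zero.1 (pow_eq_zero_iff two_ne_zero |>.1 h5))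
  rw [h6]
  exact inner_le_of_ball_subset_normalCone hM hR hε hexp hp₀ hv₀ hq

end Cones

/-! ### Comparison of volumes over a single chart. -/

section LocalComparison

open Filter Topology Metric Set

theorem _root_.ContinuousOn.measurableSet_inter_preimage {α β : Type*} [TopologicalSpace α]
    [MeasurableSpace α] [OpensMeasurableSpace α] [TopologicalSpace β] [MeasurableSpace β]
    [BorelSpace β] {f : α → β} {s : Set α} (hf : ContinuousOn f s) (hs : MeasurableSet s)
    {t : Set β} (ht : MeasurableSet t) : MeasurableSet (s ∩ f ⁻¹' t) := by
  have h1 : Measurable (s.domRestrict f) := (continuousOn_iff_continuous_domRestrict.1 hf).measurable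
  have h2 := hs.subtype_image (h1 ht)
  convert h2 using 1
  ext x
  simp [and_comm]

theorem setLIntegral_prod_comp_fst {α β : Type*} [MeasurableSpace α] [MeasurableSpace β]
    (μ : Measure α) (ν : Measure β) [SFinite μ] [SFinite ν] {k : α → ENNReal} (hk : Measurable k)
    {S : Set (α × β)} (hS : MeasurableSet S) :
    ∫⁻ z in S, k z.1 ∂(μ.prod ν) = ∫⁻ x, k x * ν (Prod.mk x ⁻¹' S) ∂μ := by
  rw [← lintegral_indicator hS, lintegral_prod (S.indicator fun z => k z.1)
    ((hk.comp measurable_fst).indicator hS).aemeasurable]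
  refine lintegral_congr fun x => ?_
  have h1 : (fun y => S.indicator (fun z : α × β => k z.1) (x, y)) =
      (Prod.mk x ⁻¹' S).indicator fun _ => k x := by
    ext y; rfl
  rw [h1, lintegral_indicator_const (measurable_prodMk_left hS)]

variable {d : ℕ} {M U : Set (EuclideanSpace ℝ (Fin D))}
  {V : Set (EuclideanSpace ℝ (Fin d))} {φ : EuclideanSpace ℝ (Fin d) → EuclideanSpace ℝ (Fin D)}

/-- The part over `B` and in `A` of the normal cones of the convex hull of `M`. -/
def coneUnion (M B A : Set (EuclideanSpace ℝ (Fin D))) : Set (EuclideanSpace ℝ (Fin D)) :=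
  {v | v ∈ A ∧ ∃ p ∈ M, p ∈ B ∧ v ∈ normalCone (convexHull ℝ M) p}

/-- The preimage of `coneUnion M B A` in the parametrized normal bundle. -/
def coneBundle (M B A : Set (EuclideanSpace ℝ (Fin D))) (V : Set (EuclideanSpace ℝ (Fin d)))
    (φ : EuclideanSpace ℝ (Fin d) → EuclideanSpace ℝ (Fin D))
    (W : Submodule ℝ (EuclideanSpace ℝ (Fin D))) : Set (EuclideanSpace ℝ (Fin d) × W) :=
  {z | z.1 ∈ V ∧ φ z.1 ∈ B ∧ bundleParam W φ z ∈ A ∧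
    bundleParam W φ z ∈ normalCone (convexHull ℝ M) (φ z.1)}

variable {W : Submodule ℝ (EuclideanSpace ℝ (Fin D))} {A B : Set (EuclideanSpace ℝ (Fin D))}

theorem measurableSet_coneBundle (h : IsChart M U V φ)
    (hW : ∀ x ∈ V, (frameMap W (fderiv ℝ φ x)).IsInvertible) (hA : MeasurableSet A)
    (hB : MeasurableSet B) : MeasurableSet (coneBundle M B A V φ W) := by
  have hs : MeasurableSet {z : EuclideanSpace ℝ (Fin d) × W | z.1 ∈ V} :=
    measurable_fst h.isOpen_source.measurableSet
  have hf : ContinuousOn (fun z : EuclideanSpace ℝ (Fin d) × W => (φ z.1, bundleParam W φ z))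
      {z | z.1 ∈ V} := fun z hz => by
    refine ContinuousAt.continuousWithinAt (ContinuousAt.prodMk ?_ ?_)
    · exact ContinuousAt.comp (f := Prod.fst) (h.contDiffAt hz).continuousAt continuousAt_fst
    · exact (differentiableAt_bundleParam (h.contDiffAt hz) (hW _ hz) z.2).continuousAt
  -- The graph of the normal cone is an intersection of closed conditions, one for each point of the
  -- convex hull.
  have hcl : IsClosed {r : EuclideanSpace ℝ (Fin D) × EuclideanSpace ℝ (Fin D) |
      r.2 ∈ normalCone (convexHull ℝ M) r.1} := by
    have : {r : EuclideanSpace ℝ (Fin D) × EuclideanSpace ℝ (Fin D) |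
        r.2 ∈ normalCone (convexHull ℝ M) r.1} =
        ⋂ x ∈ convexHull ℝ M, {r | inner ℝ r.2 (x - r.1) ≤ 0} := by
      ext r; simp [normalCone]
    rw [this]
    exact isClosed_biInter fun x _ => isClosed_le (by fun_prop) continuous_const
  have ht : MeasurableSet {r : EuclideanSpace ℝ (Fin D) × EuclideanSpace ℝ (Fin D) |
      r.1 ∈ B ∧ r.2 ∈ A ∧ r.2 ∈ normalCone (convexHull ℝ M) r.1} :=
    (measurable_fst hB).inter ((measurable_snd hA).inter hcl.measurableSet)
  exact hf.measurableSet_inter_preimage hs ht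

theorem image_coneBundle (h : IsChart M U V φ)
    (hW : ∀ x ∈ V, (frameMap W (fderiv ℝ φ x)).IsInvertible) (hB : B ⊆ U) :
    bundleParam W φ '' coneBundle M B A V φ W = coneUnion M B A := by
  ext v
  constructor
  · rintro ⟨z, ⟨hz, hzB, hzA, hzN⟩, rfl⟩
    exact ⟨hzA, φ z.1, h.apply_mem hz, hzB, hzN⟩
  · rintro ⟨hvA, p, hp, hpB, hvN⟩
    obtain ⟨x, hx, rfl⟩ := h.image_eq.ge ⟨hp, hB hpB⟩
    have hv : bundleParam W φ (x, W.orthogonalProjectionOnto v) = v :=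
      normalParam_orthogonalProjectionOnto (hW x hx) (inner_eq_zero_of_mem_normalCone h hx hvN)
    exact ⟨(x, W.orthogonalProjectionOnto v), ⟨hx, hpB, by rwa [hv], by rwa [hv]⟩, hv⟩

theorem hasFDerivWithinAt_bundleParam (h : IsChart M U V φ)
    (hW : ∀ x ∈ V, (frameMap W (fderiv ℝ φ x)).IsInvertible)
    (T : EuclideanSpace ℝ (Fin D) ≃L[ℝ] EuclideanSpace ℝ (Fin d) × W) :
    ∀ z ∈ coneBundle M B A V φ W, HasFDerivWithinAt (fun z => T (bundleParam W φ z))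
      ((T : EuclideanSpace ℝ (Fin D) →L[ℝ] EuclideanSpace ℝ (Fin d) × W).comp
        (fderiv ℝ (bundleParam W φ) z)) (coneBundle M B A V φ W) z := fun z hz =>
  ((T : EuclideanSpace ℝ (Fin D) →L[ℝ] EuclideanSpace ℝ (Fin d) × W).hasFDerivAt.comp z
    (differentiableAt_bundleParam (h.contDiffAt hz.1) (hW _ hz.1) z.2).hasFDerivAt).hasFDerivWithinAt

theorem injOn_bundleParam (h : IsChart M U V φ)
    (hW : ∀ x ∈ V, (frameMap W (fderiv ℝ φ x)).IsInvertible)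
    (hA : ∀ v ∈ A, ∀ p ∈ M, ∀ q ∈ M, v ∈ normalCone (convexHull ℝ M) p →
      v ∈ normalCone (convexHull ℝ M) q → p = q) :
    InjOn (bundleParam W φ) (coneBundle M B A V φ W) := by
  rintro ⟨x, y⟩ ⟨hx, -, hxA, hxN⟩ ⟨x', y'⟩ ⟨hx', -, -, hxN'⟩ heq
  rw [← heq] at hxN'
  obtain rfl : x = x' := h.injOn hx hx' (hA _ hxA _ (h.apply_mem hx) _ (h.apply_mem hx') hxN hxN')
  exact Prod.ext rfl (normalParam_injective (hW x hx) heq)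

theorem measurableSet_coneUnion (h : IsChart M U V φ)
    (hW : ∀ x ∈ V, (frameMap W (fderiv ℝ φ x)).IsInvertible)
    (T : EuclideanSpace ℝ (Fin D) ≃L[ℝ] EuclideanSpace ℝ (Fin d) × W)
    (hAm : MeasurableSet A) (hBm : MeasurableSet B) (hB : B ⊆ U)
    (hA : ∀ v ∈ A, ∀ p ∈ M, ∀ q ∈ M, v ∈ normalCone (convexHull ℝ M) p →
      v ∈ normalCone (convexHull ℝ M) q → p = q) :
    MeasurableSet (coneUnion M B A) := by
  have h1 := measurable_image_of_fderivWithin (measurableSet_coneBundle h hW hAm hBm)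
    (hasFDerivWithinAt_bundleParam h hW T) (T.injective.comp_injOn (injOn_bundleParam h hW hA))
  have h2 : coneUnion M B A = T ⁻¹' ((fun z => T (bundleParam W φ z)) '' coneBundle M B A V φ W) := by
    rw [← image_coneBundle h hW hB, ← image_image T, preimage_image_eq _ T.injective]
  rw [h2]
  exact T.continuous.measurable h1

/-- The constant relating the volume to the product measure on `ℝ^d × W`. -/
theorem exists_volume_preimage_eq
    (T : EuclideanSpace ℝ (Fin D) ≃L[ℝ] EuclideanSpace ℝ (Fin d) × W) :
    ∃ c : ENNReal, ∀ s : Set (EuclideanSpace ℝ (Fin D)), volume s =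
      c * ((volume : Measure (EuclideanSpace ℝ (Fin d))).prod
        (μHE[Module.finrank ℝ W] : Measure W)) (T '' s) := by
  set ν := (volume : Measure (EuclideanSpace ℝ (Fin d))).prod
    (μHE[Module.finrank ℝ W] : Measure W)
  have : (volume.map T).IsAddHaarMeasure := T.isAddHaarMeasure_map volume
  refine ⟨(volume.map T).addHaarScalarFactor ν, fun s => ?_⟩
  have h1 := Measure.isAddLeftInvariant_eq_smul (volume.map T) ν
  have h2 : volume s = (volume.map T) (T '' s) := by
    rw [show (volume.map T : Measure (EuclideanSpace ℝ (Fin d) × W)) =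
      volume.map T.toHomeomorph.toMeasurableEquiv from rfl, MeasurableEquiv.map_apply]
    exact congrArg _ (preimage_image_eq s T.injective).symm
  rw [h2]
  exact congrArg (fun μ : Measure (EuclideanSpace ℝ (Fin d) × W) => μ (T '' s)) h1

variable (h : IsChart M U V φ) (hW : ∀ x ∈ V, (frameMap W (fderiv ℝ φ x)).IsInvertible)
  (T : EuclideanSpace ℝ (Fin D) ≃L[ℝ] EuclideanSpace ℝ (Fin d) × W)

include h hW

theorem image_coneUnion (hB : B ⊆ U) : T '' coneUnion M B A =
    (fun z => T (bundleParam W φ z)) '' coneBundle M B A V φ W := by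
  rw [← image_coneBundle h hW hB, image_image]

theorem ofReal_det_fderiv_le {τ : ℝ} (hτ : 0 < τ)
    (hA : ∀ p ∈ M, ∀ v ∈ A, v ∈ normalCone (convexHull ℝ M) p → ∀ q ∈ M,
      inner ℝ (-v) (q - p) ≤ 1 / (2 * τ) * ‖q - p‖ ^ 2)
    {z : EuclideanSpace ℝ (Fin d) × W} (hz : z ∈ coneBundle M B A V φ W) :
    ENNReal.ofReal |((T : EuclideanSpace ℝ (Fin D) →L[ℝ] EuclideanSpace ℝ (Fin d) × W).comp
        (fderiv ℝ (bundleParam W φ) z)).det| ≤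
      ENNReal.ofReal ((1 / τ) ^ d) * ENNReal.ofReal (baseDensity W φ T z.1) := by
  obtain ⟨x, y⟩ := z
  obtain ⟨hx, -, hzA, hzN⟩ := hz
  rw [← ENNReal.ofReal_mul (by positivity)]
  refine ENNReal.ofReal_le_ofReal ?_
  rw [det_fderiv_bundleParam (h.contDiffAt hx) (hW x hx), abs_mul, baseDensity]
  have h1 := fun a => (h.inner_conditions hx (w := bundleParam W φ (x, y)) (c := 0) (fun q hq => by
    simpa using mem_normalCone_convexHull_iff.1 hzN q hq) a).2
  have h2 := fun a => (h.inner_conditions hx (w := -bundleParam W φ (x, y)) (c := 1 / (2 * τ))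
    (hA _ (h.apply_mem hx) _ hzA hzN) a).2
  have h3 := det_shapeMap_le (h.contDiffAt hx) (h.injective_fderiv x hx)
    (v := bundleParam W φ (x, y)) (fun a => by simpa using h1 a) (one_div_pos.2 hτ)
    (fun a => (h2 a).trans_eq (by field_simp))
  rw [finrank_euclideanSpace_fin] at h3
  calc _ ≤ _ := mul_le_mul_of_nonneg_left h3 (abs_nonneg _)
    _ = _ := by ring

theorem le_ofReal_det_fderiv {c : ℝ} (hc : 0 < c)
    (hA : ∀ p ∈ M, ∀ v ∈ A, v ∈ normalCone (convexHull ℝ M) p → ∀ q ∈ M,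
      inner ℝ v (q - p) ≤ -(c / 2) * ‖q - p‖ ^ 2)
    {z : EuclideanSpace ℝ (Fin d) × W} (hz : z ∈ coneBundle M B A V φ W) :
    ENNReal.ofReal (c ^ d) * ENNReal.ofReal (baseDensity W φ T z.1) ≤
    ENNReal.ofReal |((T : EuclideanSpace ℝ (Fin D) →L[ℝ] EuclideanSpace ℝ (Fin d) × W).comp
        (fderiv ℝ (bundleParam W φ) z)).det| := by
  obtain ⟨x, y⟩ := z
  obtain ⟨hx, -, hzA, hzN⟩ := hz
  rw [← ENNReal.ofReal_mul (by positivity)]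
  refine ENNReal.ofReal_le_ofReal ?_
  rw [det_fderiv_bundleParam (h.contDiffAt hx) (hW x hx), abs_mul, baseDensity]
  have h2 := fun a => (h.inner_conditions hx (w := bundleParam W φ (x, y)) (c := -(c / 2))
    (hA _ (h.apply_mem hx) _ hzA hzN) a).2
  have h3 := le_det_shapeMap (h.contDiffAt hx) (h.injective_fderiv x hx)
    (v := bundleParam W φ (x, y)) hc (fun a => (h2 a).trans_eq (by ring))
  rw [finrank_euclideanSpace_fin] at h3
  refine le_trans (le_of_eq ?_) (mul_le_mul_of_nonneg_left h3 (abs_nonneg _))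
  ring

/-- `normalParam` carries the fibers linearly onto subsets of the true normal cone and scales both
measures by the same finite nonzero constant, which cancels. On the `G` side the restriction to the
unit ball is dropped. -/
theorem measure_fiber_le {G : Set (EuclideanSpace ℝ (Fin D))} {m : ENNReal}
    (hm : ∀ p ∈ M, m ≤ μHE[Module.finrank ℝ W] (unitNormalCone (convexHull ℝ M) p ∩ G) /
      μHE[Module.finrank ℝ W] (unitNormalCone (convexHull ℝ M) p))
    (x : EuclideanSpace ℝ (Fin d)) :
    m * (μHE[Module.finrank ℝ W] : Measure W) (Prod.mk x ⁻¹' coneBundle M B (ball 0 1) V φ W) ≤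
      (μHE[Module.finrank ℝ W] : Measure W) (Prod.mk x ⁻¹' coneBundle M B G V φ W) := by
  by_cases hx : x ∈ V ∧ φ x ∈ B
  · set L := normalParam W (fderiv ℝ φ x) with hL
    obtain ⟨c, hc0, hct, hc⟩ := exists_euclideanHausdorffMeasure_image_eq L.toLinearMap
      (normalParam_injective (hW x hx.1))
    have himg : ∀ s ⊆ normalCone (convexHull ℝ M) (φ x), L '' (L ⁻¹' s) = s := fun s hs =>
      image_preimage_eq_of_subset fun v hv => ⟨W.orthogonalProjectionOnto v,
        normalParam_orthogonalProjectionOnto (hW x hx.1)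
          (inner_eq_zero_of_mem_normalCone h hx.1 (hs hv))⟩
    have h1 := hc (L ⁻¹' unitNormalCone (convexHull ℝ M) (φ x))
    have h2 := hc (L ⁻¹' (unitNormalCone (convexHull ℝ M) (φ x) ∩ G))
    rw [show (L.toLinearMap : W → _) = L from rfl, himg (unitNormalCone _ _) inter_subset_left] at h1
    rw [show (L.toLinearMap : W → _) = L from rfl,
      himg (unitNormalCone _ _ ∩ G) (inter_subset_left.trans inter_subset_left)] at h2
    -- `ENNReal.mul_div_le` needs no side condition, so cones of measure zero or infinity require no
    -- separate case.
    have h3 := (mul_le_mul_left (hm _ (h.apply_mem hx.1)) _).trans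
      ((mul_comm _ _).trans_le ENNReal.mul_div_le)
    rw [h1, h2, mul_left_comm, ENNReal.mul_le_mul_iff_right hc0 hct] at h3
    refine le_trans (le_of_eq ?_) (h3.trans (measure_mono ?_))
    · congr 2
      ext y
      exact ⟨fun hy => ⟨hy.2.2.2, hy.2.2.1⟩, fun hy => ⟨hx.1, hx.2, hy.2, hy.1⟩⟩
    · exact fun y hy => ⟨hx.1, hx.2, hy.2, hy.1.1⟩
  · have : Prod.mk x ⁻¹' coneBundle M B (ball 0 1) V φ W = ∅ :=
      eq_empty_of_forall_notMem fun y hy => hx ⟨hy.1, hy.2.1⟩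
    rw [this, measure_empty, mul_zero]
    exact zero_le

include T in
-- A vector of the unit ball may be normal at several points, so there only the area inequality is
-- used. On `G` the base point is unique and the change of variables is exact. The constant `κ` from
-- the choice of `T` appears on both sides.
theorem volume_coneUnion_le {τ c : ℝ} (hτ : 0 < τ) (hc : 0 < c)
    (hball : ∀ p ∈ M, ∀ v ∈ ball (0 : EuclideanSpace ℝ (Fin D)) 1,
      v ∈ normalCone (convexHull ℝ M) p → ∀ q ∈ M,
        inner ℝ (-v) (q - p) ≤ 1 / (2 * τ) * ‖q - p‖ ^ 2)
    {G : Set (EuclideanSpace ℝ (Fin D))} (hGm : MeasurableSet G)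
    (hG : ∀ p ∈ M, ∀ v ∈ G, v ∈ normalCone (convexHull ℝ M) p → ∀ q ∈ M,
      inner ℝ v (q - p) ≤ -(c / 2) * ‖q - p‖ ^ 2)
    (hGu : ∀ v ∈ G, ∀ p ∈ M, ∀ q ∈ M, v ∈ normalCone (convexHull ℝ M) p →
      v ∈ normalCone (convexHull ℝ M) q → p = q)
    {m : ENNReal}
    (hm : ∀ p ∈ M, m ≤ μHE[Module.finrank ℝ W] (unitNormalCone (convexHull ℝ M) p ∩ G) /
      μHE[Module.finrank ℝ W] (unitNormalCone (convexHull ℝ M) p))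
    (hBm : MeasurableSet B) (hB : B ⊆ U) :
    ENNReal.ofReal ((c * τ) ^ d) * m * volume (coneUnion M B (ball 0 1)) ≤
      volume (coneUnion M B G) := by
  obtain ⟨κ, hκ⟩ := exists_volume_preimage_eq T
  set ν := (volume : Measure (EuclideanSpace ℝ (Fin d))).prod
    (μHE[Module.finrank ℝ W] : Measure W) with hν
  set S := coneBundle M B (ball 0 1) V φ W with hS
  set S' := coneBundle M B G V φ W with hS'
  have hSm : MeasurableSet S := measurableSet_coneBundle h hW measurableSet_ball hBm
  have hSm' : MeasurableSet S' := measurableSet_coneBundle h hW hGm hBm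
  set k : EuclideanSpace ℝ (Fin d) → ENNReal :=
    V.indicator fun x => ENNReal.ofReal (baseDensity W φ T x) with hk
  have hkm : Measurable k := by
    classical
    rw [hk, ← piecewise_eq_indicator]
    exact (ENNReal.continuous_ofReal.comp_continuousOn (continuousOn_baseDensity
      (fun x hx => h.contDiffAt hx) hW _)).measurable_piecewise continuousOn_const
      h.isOpen_source.measurableSet
  have hkm' : Measurable fun z : EuclideanSpace ℝ (Fin d) × W => k z.1 := hkm.comp measurable_fst
  have hkS : ∀ z ∈ S, ENNReal.ofReal (baseDensity W φ T z.1) = k z.1 := fun z hz =>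
    (indicator_of_mem (f := fun x => ENNReal.ofReal (baseDensity W φ T x)) hz.1).symm
  have hkS' : ∀ z ∈ S', ENNReal.ofReal (baseDensity W φ T z.1) = k z.1 := fun z hz =>
    (indicator_of_mem (f := fun x => ENNReal.ofReal (baseDensity W φ T x)) hz.1).symm
  have hup : volume (coneUnion M B (ball 0 1)) ≤
      κ * (ENNReal.ofReal ((1 / τ) ^ d) * ∫⁻ z in S, k z.1 ∂ν) := by
    rw [hκ, image_coneUnion h hW T hB]
    gcongr
    refine (addHaar_image_le_lintegral_abs_det_fderiv ν hSm
      (hasFDerivWithinAt_bundleParam h hW T)).trans ?_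
    rw [← lintegral_const_mul _ hkm']
    refine setLIntegral_mono' hSm fun z hz => ?_
    exact (ofReal_det_fderiv_le h hW T hτ hball hz).trans_eq (by rw [hkS z hz])
  have hlow : κ * (ENNReal.ofReal (c ^ d) * ∫⁻ z in S', k z.1 ∂ν) ≤ volume (coneUnion M B G) := by
    rw [hκ, image_coneUnion h hW T hB]
    gcongr
    rw [← lintegral_abs_det_fderiv_eq_addHaar_image ν hSm' (hasFDerivWithinAt_bundleParam h hW T)
      (T.injective.comp_injOn (injOn_bundleParam h hW hGu)),
      ← lintegral_const_mul _ hkm']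
    refine setLIntegral_mono' hSm' fun z hz => ?_
    exact (le_of_eq (by rw [hkS' z hz])).trans (le_ofReal_det_fderiv h hW T hc hG hz)
  have hfm : Measurable fun x => k x * (μHE[Module.finrank ℝ W] : Measure W) (Prod.mk x ⁻¹' S) :=
    hkm.mul (measurable_measure_prodMk_left hSm)
  have hfib : m * ∫⁻ z in S, k z.1 ∂ν ≤ ∫⁻ z in S', k z.1 ∂ν := by
    rw [setLIntegral_prod_comp_fst _ _ hkm hSm, setLIntegral_prod_comp_fst _ _ hkm hSm',
      ← lintegral_const_mul _ hfm]
    refine lintegral_mono fun x => ?_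
    rw [mul_left_comm]
    gcongr
    exact measure_fiber_le h hW hm x
  have hconst : ENNReal.ofReal ((c * τ) ^ d) * ENNReal.ofReal ((1 / τ) ^ d) =
      ENNReal.ofReal (c ^ d) := by
    rw [← ENNReal.ofReal_mul (by positivity), ← mul_pow]
    congr 2; field_simp
  calc ENNReal.ofReal ((c * τ) ^ d) * m * volume (coneUnion M B (ball 0 1))
      ≤ ENNReal.ofReal ((c * τ) ^ d) * m *
          (κ * (ENNReal.ofReal ((1 / τ) ^ d) * ∫⁻ z in S, k z.1 ∂ν)) := by gcongr
    _ = κ * ((ENNReal.ofReal ((c * τ) ^ d) * ENNReal.ofReal ((1 / τ) ^ d)) *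
          (m * ∫⁻ z in S, k z.1 ∂ν)) := by ring
    _ ≤ κ * (ENNReal.ofReal (c ^ d) * ∫⁻ z in S', k z.1 ∂ν) := by rw [hconst]; gcongr
    _ ≤ _ := hlow

end LocalComparison

/-! ### Gluing over countably many charts. -/

section Global

open Filter Topology Metric Set

variable {d : ℕ} {M : Set (EuclideanSpace ℝ (Fin D))}

theorem exists_isChart_frame (hM : IsC21Submanifold d M) {p : EuclideanSpace ℝ (Fin D)}
    (hp : p ∈ M) :
    ∃ (U : Set (EuclideanSpace ℝ (Fin D))) (V : Set (EuclideanSpace ℝ (Fin d)))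
      (φ : EuclideanSpace ℝ (Fin d) → EuclideanSpace ℝ (Fin D))
      (W : Submodule ℝ (EuclideanSpace ℝ (Fin D))), p ∈ U ∧ IsChart M U V φ ∧
      (∀ x ∈ V, (frameMap W (fderiv ℝ φ x)).IsInvertible) ∧
      Nonempty (EuclideanSpace ℝ (Fin D) ≃L[ℝ] EuclideanSpace ℝ (Fin d) × W) ∧
      Module.finrank ℝ W = D - d := by
  obtain ⟨U, V, φ, h, x, hx, rfl⟩ := hM.exists_isChart hp
  -- `W` is the normal space at the centre `x`; invertibility of the frame map is an open condition,
  -- so it survives on a smaller chart.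
  set W := (LinearMap.range (fderiv ℝ φ x).toLinearMap)ᗮ with hW
  have hinv : (frameMap W (fderiv ℝ φ x)).IsInvertible :=
    frameMap_isInvertible (h.injective_fderiv x hx) hW
  obtain ⟨V', hV'sub, hV', hxV'⟩ := _root_.eventually_nhds_iff.1
    ((h.isOpen_source.eventually_mem hx).and (eventually_frameMap_isInvertible (h.contDiffAt hx) hinv))
  obtain ⟨U', h'⟩ := h.exists_restrict hV' fun y hy => (hV'sub y hy).1
  obtain ⟨T, -⟩ := hinv
  refine ⟨U', V', φ, W, (h'.image_eq.le (mem_image_of_mem φ hxV')).2, h',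
    fun y hy => (hV'sub y hy).2, ⟨T⟩, ?_⟩
  have h1 := T.toLinearEquiv.finrank_eq
  rw [Module.finrank_prod, finrank_euclideanSpace_fin, finrank_euclideanSpace_fin] at h1
  omega

theorem subset_coneUnion_univ (hcomp : IsCompact M) (hne : M.Nonempty)
    (A : Set (EuclideanSpace ℝ (Fin D))) : A ⊆ coneUnion M univ A := by
  intro v hv
  obtain ⟨p, hp, hmax⟩ := hcomp.exists_isMaxOn hne
    (f := fun q => (inner ℝ v q : ℝ)) (by fun_prop)
  refine ⟨hv, p, hp, mem_univ p, mem_normalCone_convexHull_iff.2 fun q hq => ?_⟩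
  rw [inner_sub_right]
  exact sub_nonpos.2 (hmax hq)

/-- Gluing of a comparison of the normal cones over small sets. -/
theorem mul_volume_le_of_local (hcomp : IsCompact M) (hne : M.Nonempty)
    {A G : Set (EuclideanSpace ℝ (Fin D))} {κ : ENNReal}
    (hGu : ∀ v ∈ G, ∀ p ∈ M, ∀ q ∈ M, v ∈ normalCone (convexHull ℝ M) p →
      v ∈ normalCone (convexHull ℝ M) q → p = q)
    (hloc : ∀ p ∈ M, ∃ U, IsOpen U ∧ p ∈ U ∧ ∀ B ⊆ U, MeasurableSet B →
      MeasurableSet (coneUnion M B G) ∧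
        κ * volume (coneUnion M B A) ≤ volume (coneUnion M B G)) :
    κ * volume A ≤ volume G := by
  choose! U hU hpU hUB using hloc
  obtain ⟨s, hsM, hs, hcov⟩ := TopologicalSpace.countable_cover_nhdsWithin (s := M) (f := U)
    fun p hp => mem_nhdsWithin_of_mem_nhds ((hU p hp).mem_nhds (hpU p hp))
  have hsne : s.Nonempty := by
    obtain ⟨p, hp⟩ := hne
    obtain ⟨i, hi, -⟩ := mem_iUnion₂.1 (hcov hp)
    exact ⟨i, hi⟩
  obtain ⟨f, rfl⟩ := hs.exists_eq_range hsne
  -- Disjoint pieces of the base give disjoint parts of `G`, because a vector of `G` has only one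
  -- base point. For `A` subadditivity suffices.
  set B : ℕ → Set (EuclideanSpace ℝ (Fin D)) := disjointed fun n => U (f n) with hB
  have hfM : ∀ n, f n ∈ M := fun n => hsM (mem_range_self n)
  have hBm : ∀ n, MeasurableSet (B n) :=
    fun n => MeasurableSet.disjointed (fun n => (hU _ (hfM n)).measurableSet) n
  have hBU : ∀ n, B n ⊆ U (f n) := disjointed_subset _
  have hBcov : M ⊆ ⋃ n, B n := by
    rw [hB, iUnion_disjointed]
    rwa [biUnion_range] at hcov
  have hdisj : Pairwise (Function.onFun Disjoint fun n => coneUnion M (B n) G) := by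
    intro i j hij
    refine Set.disjoint_left.2 ?_
    rintro v ⟨hv, p, hp, hpB, hvp⟩ ⟨-, q, hq, hqB, hvq⟩
    obtain rfl := hGu v hv p hp q hq hvp hvq
    exact Set.disjoint_left.1 (disjoint_disjointed _ hij) hpB hqB
  have hA : A ⊆ ⋃ n, coneUnion M (B n) A := by
    intro v hv
    obtain ⟨-, p, hp, -, hvp⟩ := subset_coneUnion_univ hcomp hne A hv
    obtain ⟨n, hn⟩ := mem_iUnion.1 (hBcov hp)
    exact mem_iUnion.2 ⟨n, hv, p, hp, hn, hvp⟩
  calc κ * volume A ≤ κ * ∑' n, volume (coneUnion M (B n) A) := by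
        gcongr
        exact (measure_mono hA).trans (measure_iUnion_le _)
    _ = ∑' n, κ * volume (coneUnion M (B n) A) := ENNReal.tsum_mul_left.symm
    _ ≤ ∑' n, volume (coneUnion M (B n) G) :=
        ENNReal.tsum_le_tsum fun n => (hUB _ (hfM n) (B n) (hBU n) (hBm n)).2
    _ = volume (⋃ n, coneUnion M (B n) G) :=
        (measure_iUnion hdisj fun n => (hUB _ (hfM n) (B n) (hBU n) (hBm n)).1).symm
    _ ≤ volume G := measure_mono (iUnion_subset fun n v hv => hv.1)

end Global

end NormalCones

theorem mainTheorem5 {D d : ℕ} (M : Set (EuclideanSpace ℝ (Fin D)))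
    (hM : NormalCones.IsC21Submanifold d M) (hcomp : IsCompact M) (hne : M.Nonempty)
    (τ R ε : ℝ) (hτ : 0 < τ) (hR : 0 < R) (hε : 0 < ε)
    (hreach : ENNReal.ofReal τ ≤ NormalCones.reach M) (hexp : NormalCones.IsExposed R M)
    (G : Set (EuclideanSpace ℝ (Fin D))) (hG : MeasurableSet G)
    (hGN : ∀ v ∈ G, ∃ p ∈ M,
      v ∈ intrinsicInterior ℝ (NormalCones.normalCone (convexHull ℝ M) p) ∧
      ∀ w ∈ NormalCones.normalSpace M p, w ∈ Metric.ball 0 ε →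
        v + w ∈ NormalCones.normalCone (convexHull ℝ M) p) :
    ENNReal.ofReal ((ε * τ / R) ^ d) *
        ⨅ p ∈ M, μHE[D - d] (NormalCones.unitNormalCone (convexHull ℝ M) p ∩ G) /
          μHE[D - d] (NormalCones.unitNormalCone (convexHull ℝ M) p)
      ≤ volume G / volume (Metric.ball (0 : EuclideanSpace ℝ (Fin D)) 1) := by
  have hGq : ∀ p ∈ M, ∀ v ∈ G, v ∈ NormalCones.normalCone (convexHull ℝ M) p → ∀ q ∈ M,
      inner ℝ v (q - p) ≤ -(ε / (2 * R)) * ‖q - p‖ ^ 2 := fun p hp v hv hvp q hq =>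
    NormalCones.inner_le_of_mem_normalCone hM hR hε hexp
      ((hGN v hv).imp fun p h => ⟨h.1, h.2.2⟩) hp hvp hq
  have hGu : ∀ v ∈ G, ∀ p ∈ M, ∀ q ∈ M, v ∈ NormalCones.normalCone (convexHull ℝ M) p →
      v ∈ NormalCones.normalCone (convexHull ℝ M) q → p = q := by
    intro v hv p hp q hq hvp hvq
    have h1 := hGq p hp v hv hvp q hq
    have h2 := NormalCones.mem_normalCone_convexHull_iff.1 hvq p hp
    rw [← neg_sub, inner_neg_right] at h2
    have h3 : 0 < ε / (2 * R) := by positivity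
    by_contra hne
    have h4 : 0 < ‖q - p‖ := norm_pos_iff.2 (sub_ne_zero.2 (Ne.symm hne))
    have h5 : 0 < ε / (2 * R) * ‖q - p‖ ^ 2 := by positivity
    linarith
  have hpos : volume (Metric.ball (0 : EuclideanSpace ℝ (Fin D)) 1) ≠ 0 :=
    (Metric.measure_ball_pos volume _ one_pos).ne'
  rw [ENNReal.le_div_iff_mul_le (Or.inl hpos) (Or.inl measure_ball_lt_top.ne)]
  refine NormalCones.mul_volume_le_of_local hcomp hne hGu fun p hp => ?_
  obtain ⟨U, V, φ, W, hpU, h, hW, ⟨T⟩, hfr⟩ := NormalCones.exists_isChart_frame hM hp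
  refine ⟨U, h.isOpen_target, hpU, fun B hB hBm =>
    ⟨NormalCones.measurableSet_coneUnion h hW T hG hBm hB hGu, ?_⟩⟩
  -- Rewrites `ε * τ / R` as `ε / R * τ`, to apply the local comparison with `c = ε / R`.
  rw [mul_div_right_comm]
  refine NormalCones.volume_coneUnion_le h hW T hτ (div_pos hε hR)
    (fun p hp v hv hvp q hq => NormalCones.inner_neg_le_of_mem_normalCone hM hcomp hτ hreach hp hvp
      (mem_ball_zero_iff.1 hv).le hq) hG
    (fun p hp v hv hvp q hq => (hGq p hp v hv hvp q hq).trans_eq (by rw [div_div, mul_comm R])) hGu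
    (fun p hp => ?_) hBm hB
  rw [hfr]
  exact iInf₂_le p hp
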